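/- Let $d,p\ge 1$ be integers, let $\Delta$ be the discrete Laplacian $(\Delta u)_n=\sum_{j=1}^d(u_{n+e_j}+u_{n-e_j}-2u_n)$ on $\ell^2(\mathbb Z^d)$, and let $\gamma_p=\binom{2p+1}{p+1}$. Let $\Omega\in\mathbb R\setminus[-4d,0]$, and let $\mathcal A\in\ell^2(\mathbb Z^d)$ be a real solution of $$\Omega\mathcal A+\gamma_p|\mathcal A|^{2p}\mathcal A=\Delta\mathcal A$$ such that $L_+:=\Omega-\Delta+(1+2p)\gamma_p|\mathcal A|^{2p}$ has trivial kernel in $\ell^2(\mathbb Z^d)$. Put $L_-:=\Omega-\Delta+\gamma_p|\mathcal A|^{2p}$ and $\mathcal J\mathcal H''(\mathcal A)(b_+,b_-):=(-L_-b_-,\,L_+b_+)$ on $\ell^2(\mathbb Z^d)\times\ell^2(\mathbb Z^d)$. Let $\Lambda\in\mathbb C$ be such that $2\Lambda$ is an (algebraically) simple eigenvalue of $\mathcal J\mathcal H''(\mathcal A)$, isolated in its spectrum, with eigenvector $(b_+,b_-)$, and such that $2\Lambda$ does not lie in the continuous spectrum $i[\Omega,\Omega+4d]\cup -i[\Omega,\Omega+4d]$.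 Denote by $\ell^{2,2}(\mathbb Z;\ell^2(\mathbb Z^d))$ the space of sequences $B=\{B^{(m)}\}_{m\in\mathbb Z}$ with norm $\big(\sum_m(1+m^2)^2\|B^{(m)}\|_{\ell^2}^2\big)^{1/2}<\infty$. A breather branch is a pair of analytic functions $\omega(\epsilon)\in\mathbb R$, $A(\epsilon)\in\ell^{2,2}(\mathbb Z;\ell^2(\mathbb Z^d))$ on an interval $(0,\epsilon_1)$, $\epsilon_1>0$, with $A^{(m)}=A^{(-m)}$ real, such that, with $U(\tau)=\sum_mA^{(m)}e^{im\tau}$ and componentwise products, $$(1-m^2\omega^2)A^{(m)}+\frac{\epsilon}{2\pi}\int_{-\pi}^{\pi}U^{1+2p}(\tau)e^{-im\tau}\,d\tau=\epsilon\Delta A^{(m)},\quad m\in\mathbb Z,$$ and such that for some constant $C_1$ and all $\epsilon\in(0,\epsilon_1)$ $$|\omega(\epsilon)-1+\tfrac12\epsilon\Omega|\le C_1\epsilon^2,\qquad \|A^{(0)}\|_{\ell^2}+\|A^{(1)}-\mathcal A\|_{\ell^2}+\sum_{m\ge2}\|A^{(m)}\|_{\ell^2}\le C_1\epsilon .$$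 Then a breather branch exists, and one can choose it analytic also at $\epsilon=0$. Moreover, for every breather branch there are $\epsilon_0\in(0,\epsilon_1]$, $C_0>0$, $\delta\ge C_0\epsilon_0$ and analytic functions $\lambda(\epsilon)\in\mathbb C$, $B(\epsilon)\in\ell^{2,2}(\mathbb Z;\ell^2(\mathbb Z^d))\setminus\{0\}$ on $(0,\epsilon_0)$ (analytic also at $\epsilon=0$ if $\omega$ and $A$ are) such that, for every $\epsilon\in(0,\epsilon_0)$, the pair $(\lambda,B)=(\lambda(\epsilon),B(\epsilon))$ solves the Floquet spectral problem $$\big[1+(\lambda+im\omega)^2\big]B^{(m)}+\frac{\epsilon(1+2p)}{2\pi}\int_{-\pi}^{\pi}U^{2p}(\tau)W(\tau)e^{-im\tau}\,d\tau=\epsilon\Delta B^{(m)},\quad m\in\mathbb Z,\qquad W(\tau)=\sum_mB^{(m)}e^{im\tau},$$ and satisfies $$|\lambda(\epsilon)-\epsilon\Lambda|\le C_0\epsilon^2,\qquad \|B^{(1)}-b_+-ib_-\|_{\ell^2}+\|B^{(-1)}-b_++ib_-\|_{\ell^2}\le C_0\epsilon,\qquad \sum_{m\ne\pm1}\|B^{(m)}\|_{\ell^2}\le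 C_0\epsilon .$$ The branch is unique, the eigenvector up to a scalar factor: for every $\epsilon\in(0,\epsilon_0)$, if $(\mu,D)$ with $0\ne D\in\ell^{2,2}(\mathbb Z;\ell^2(\mathbb Z^d))$ solves the Floquet spectral problem at $\epsilon$ and $|\mu-\epsilon\Lambda|\le\delta\epsilon$, then $\mu=\lambda(\epsilon)$ and $D=c\,B(\epsilon)$ for some $c\in\mathbb C$. -/

import Mathlib

open scoped Topology

noncomputable section

namespace KGBreather

/-- The space `ℓ²(ℤ^d)` of square-summable complex sequences. -/
abbrev L2Z (d : ℕ) : Type := lp (fun _ : Fin d → ℤ => ℂ) 2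

/-- The discrete Laplacian on sequences:
`(Δ u)_n = ∑_j (u_{n+e_j} + u_{n-e_j} - 2 u_n)`. -/
def lap {d : ℕ} (u : (Fin d → ℤ) → ℂ) (n : Fin d → ℤ) : ℂ :=
  ∑ j : Fin d, (u (n + Pi.single j 1) + u (n - Pi.single j 1) - 2 * u n)

/-- Translation `f ↦ f(· + k)` as a bounded operator on `ℓ²(ℤ^d)`. -/
def shiftOp {d : ℕ} (k : Fin d → ℤ) : L2Z d →L[ℂ] L2Z d :=
  LinearMap.mkContinuous
    { toFun := fun f => ⟨fun n => f (n + k), by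
        have h2 : 0 < (2 : ENNReal).toReal := by norm_num
        refine memℓp_gen ?_
        exact ((lp.memℓp f).summable h2).comp_injective (add_left_injective k)⟩
      map_add' := fun _ _ => rfl
      map_smul' := fun _ _ => rfl }
    1
    (fun f => by
      have h2 : 0 < (2 : ENNReal).toReal := by norm_num
      rw [one_mul]
      refine lp.norm_le_of_tsum_le h2 (norm_nonneg _) ?_
      rw [lp.norm_rpow_eq_tsum h2 f]
      exact ((Equiv.addRight k).tsum_eq (fun n => ‖f n‖ ^ (2 : ENNReal).toReal)).le)

/-- The discrete Laplacian as a bounded operator on `ℓ²(ℤ^d)`. -/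
def lapOp (d : ℕ) : L2Z d →L[ℂ] L2Z d :=
  ∑ j : Fin d, (shiftOp (Pi.single j 1) + shiftOp (-Pi.single j 1)
    - (2 : ℂ) • ContinuousLinearMap.id ℂ (L2Z d))

theorem lapOp_apply {d : ℕ} (f : L2Z d) (n : Fin d → ℤ) : lapOp d f n = lap f n := by
  simp only [lapOp, lap, sum_apply, lp.coeFn_sum, Finset.sum_apply]
  refine Finset.sum_congr rfl fun j _ => ?_
  rw [sub_eq_add_neg n]
  rfl

/-- Multiplication by the bounded sequence `|A|^{2p}` on `ℓ²(ℤ^d)`. -/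
def potOp {d : ℕ} (p : ℕ) (A : L2Z d) : L2Z d →L[ℂ] L2Z d :=
  lp.mapCLM 2
    (fun n => ((‖A n‖ ^ (2 * p) : ℝ) : ℂ) • ContinuousLinearMap.id ℂ ℂ)
    (K := ‖A‖ ^ (2 * p)) (by positivity)
    (fun n => by
      have h : ‖A n‖ ≤ ‖A‖ := lp.norm_apply_le_norm two_ne_zero A n
      simpa [norm_smul] using pow_le_pow_left₀ (norm_nonneg _) h (2 * p))

theorem potOp_apply {d : ℕ} (p : ℕ) (A f : L2Z d) (n : Fin d → ℤ) :
    potOp p A f n = ((‖A n‖ ^ (2 * p) : ℝ) : ℂ) * f n := by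
  simp [potOp]

/-- `γ_p = (2p+1)! / (p! (p+1)!)`. -/
def gam (p : ℕ) : ℕ := Nat.choose (1 + 2 * p) (1 + p)

/-- The stationary dNLS equation `Ω A + γ_p |A|^{2p} A = Δ A`. -/
def IsSoliton {d : ℕ} (p : ℕ) (Ω : ℝ) (A : L2Z d) : Prop :=
  ∀ n, (Ω : ℂ) * A n + (gam p : ℂ) * ((‖A n‖ ^ (2 * p) : ℝ) : ℂ) * A n = lap A n

/-- `L₊ = Ω - Δ + (1+2p) γ_p |A|^{2p}`, the Jacobian operator of the stationary dNLS equation. -/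
def Lplus {d : ℕ} (p : ℕ) (Ω : ℝ) (A : L2Z d) : L2Z d →L[ℂ] L2Z d :=
  (Ω : ℂ) • ContinuousLinearMap.id ℂ (L2Z d) + ((1 + 2 * p) * gam p : ℂ) • potOp p A - lapOp d

/-- `L₋ = Ω - Δ + γ_p |A|^{2p}`. -/
def Lminus {d : ℕ} (p : ℕ) (Ω : ℝ) (A : L2Z d) : L2Z d →L[ℂ] L2Z d :=
  (Ω : ℂ) • ContinuousLinearMap.id ℂ (L2Z d) + (gam p : ℂ) • potOp p A - lapOp d

/-- The dNLS linearization `𝒥ℋ''(A) (b₊, b₋) = (-L₋ b₋, L₊ b₊)` on `ℓ² × ℓ²`. -/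
def JH {d : ℕ} (p : ℕ) (Ω : ℝ) (A : L2Z d) : (L2Z d × L2Z d) →L[ℂ] (L2Z d × L2Z d) :=
  (-(Lminus p Ω A ∘L ContinuousLinearMap.snd ℂ (L2Z d) (L2Z d))).prod
    (Lplus p Ω A ∘L ContinuousLinearMap.fst ℂ (L2Z d) (L2Z d))

/-- The continuous spectrum `i[Ω, Ω+4d] ∪ -i[Ω, Ω+4d]` of `𝒥ℋ''(A)`. -/
def contSpectrum (d : ℕ) (Ω : ℝ) : Set ℂ :=
  {z | ∃ s ∈ Set.Icc Ω (Ω + 4 * d), z = Complex.I * s ∨ z = -(Complex.I * s)}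

/-- `Λ` is a simple isolated eigenvalue of `𝒥ℋ''(A) f = 2 Λ f` with eigenvector `f`:
the generalized eigenspace of the eigenvalue `2Λ` is one-dimensional, and `2Λ` is an isolated
point of the spectrum. -/
structure IsSimpleIsolatedEigenpair {d : ℕ} (p : ℕ) (Ω : ℝ) (A : L2Z d) (Lam : ℂ)
    (f : L2Z d × L2Z d) : Prop where
  ne_zero : f ≠ 0
  eigen : JH p Ω A f = (2 * Lam) • f
  simple : Module.finrank ℂ (Module.End.maxGenEigenspace
    (JH p Ω A : Module.End ℂ (L2Z d × L2Z d)) (2 * Lam)) = 1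
  isolated : ∀ᶠ z in 𝓝[≠] (2 * Lam), z ∉ spectrum ℂ (JH p Ω A)

/-- The sequences of harmonics `(B^{(m)})_{m ∈ ℤ}` in `ℓ²(ℤ^d)` with
`((1+m²) B^{(m)})_m ∈ ℓ²(ℤ; ℓ²(ℤ^d))`. -/
def harmonicsSubmodule (d : ℕ) : Submodule ℂ (ℤ → L2Z d) where
  carrier := {B | Memℓp (fun m : ℤ => (1 + (m : ℂ) ^ 2) • B m) 2}
  add_mem' := fun {B C} hB hC => by
    have h := Memℓp.add hB hC
    have e : (fun m : ℤ => (1 + (m : ℂ) ^ 2) • (B + C) m)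
        = (fun m : ℤ => (1 + (m : ℂ) ^ 2) • B m) + fun m : ℤ => (1 + (m : ℂ) ^ 2) • C m := by
      funext m
      simp
    simpa only [Set.mem_ofPred_eq, e] using h
  zero_mem' := by
    have e : (fun m : ℤ => (1 + (m : ℂ) ^ 2) • (0 : ℤ → L2Z d) m) = 0 := by
      funext m
      simp
    simpa only [Set.mem_ofPred_eq, e] using zero_memℓp
  smul_mem' := fun c B hB => by
    have h := Memℓp.const_smul hB c
    have e : (fun m : ℤ => (1 + (m : ℂ) ^ 2) • (c • B) m)
        = c • fun m : ℤ => (1 + (m : ℂ) ^ 2) • B m := by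
      funext m
      simp [smul_comm c]
    simpa only [Set.mem_ofPred_eq, e] using h

/-- The space `ℓ^{2,2}(ℤ; ℓ²(ℤ^d))`, as a type of its own so that it carries its weighted norm
and not the product topology. -/
def X2 (d : ℕ) : Type := harmonicsSubmodule d

instance (d : ℕ) : AddCommGroup (X2 d) := inferInstanceAs (AddCommGroup (harmonicsSubmodule d))

instance (d : ℕ) : Module ℂ (X2 d) := inferInstanceAs (Module ℂ (harmonicsSubmodule d))

/-- The `m`-th harmonic `B^{(m)}`. -/
def X2.harm {d : ℕ} (B : X2 d) (m : ℤ) : L2Z d := B.1 m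

/-- The map `B ↦ ((1+m²) B^{(m)})_m` into `ℓ²(ℤ; ℓ²(ℤ^d))`. -/
def X2.weight (d : ℕ) : X2 d →ₗ[ℂ] lp (fun _ : ℤ => L2Z d) 2 where
  toFun B := ⟨fun m => (1 + (m : ℂ) ^ 2) • B.harm m, B.2⟩
  map_add' _ _ := by
    apply lp.ext
    funext m
    exact smul_add _ _ _
  map_smul' c B := by
    apply lp.ext
    funext m
    exact smul_comm (1 + (m : ℂ) ^ 2) c (B.harm m)

theorem X2.weight_injective (d : ℕ) : Function.Injective (X2.weight d) := by
  intro B C h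
  apply Subtype.ext
  funext m
  have h1 : (1 + (m : ℂ) ^ 2) • B.harm m = (1 + (m : ℂ) ^ 2) • C.harm m :=
    congrArg (fun F : lp (fun _ : ℤ => L2Z d) 2 => F m) h
  have h2 : (1 + (m : ℂ) ^ 2) ≠ 0 := by
    have h3 : (1 + (m : ℝ) ^ 2) ≠ 0 := by positivity
    exact_mod_cast h3
  exact smul_right_injective _ h2 h1

/-- The norm `‖B‖ = (∑_m (1+m²)² ‖B^{(m)}‖²)^{1/2}`. -/
instance (d : ℕ) : NormedAddCommGroup (X2 d) :=
  NormedAddCommGroup.induced (X2 d) (lp (fun _ : ℤ => L2Z d) 2) (X2.weight d)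
    (X2.weight_injective d)

instance (d : ℕ) : NormedSpace ℂ (X2 d) :=
  NormedSpace.induced ℂ (X2 d) (lp (fun _ : ℤ => L2Z d) 2) (X2.weight d)

/-- The `n`-th component of the periodic function with harmonics `B`:
`τ ↦ ∑_m B^{(m)}_n e^{imτ}`. -/
def profile {d : ℕ} (B : X2 d) (n : Fin d → ℤ) (τ : ℝ) : ℂ :=
  ∑' m : ℤ, B.harm m n * Complex.exp (Complex.I * m * τ)

/-- The breather equation in Fourier coefficients, for real harmonics that are even in `m`. -/
structure IsBreather {d : ℕ} (p : ℕ) (ε ω : ℝ) (A : X2 d) : Prop where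
  real : ∀ m n, (A.harm m n).im = 0
  even : ∀ m, A.harm (-m) = A.harm m
  eq : ∀ (m : ℤ) (n : Fin d → ℤ),
    (1 - (m : ℂ) ^ 2 * (ω : ℂ) ^ 2) * A.harm m n
      + (ε : ℂ) / (2 * Real.pi) * (∫ τ in (-Real.pi)..Real.pi,
          profile A n τ ^ (1 + 2 * p) * Complex.exp (-(Complex.I * m * τ)))
      = (ε : ℂ) * lap (A.harm m) n

/-- `ω(ε)`, `A(ε)` is an analytic branch of breathers on `(0, ε₁)` that bifurcates from the dNLS
soliton `A₀` with frequency parameter `Ω`. -/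
structure IsBreatherBranch {d : ℕ} (p : ℕ) (Ω : ℝ) (A₀ : L2Z d) (ε₁ C₁ : ℝ)
    (ω : ℝ → ℝ) (A : ℝ → X2 d) : Prop where
  analytic_freq : AnalyticOnNhd ℝ ω (Set.Ioo 0 ε₁)
  analytic_harm : AnalyticOnNhd ℝ A (Set.Ioo 0 ε₁)
  breather : ∀ ε ∈ Set.Ioo 0 ε₁, IsBreather p ε (ω ε) (A ε)
  freq_bound : ∀ ε ∈ Set.Ioo 0 ε₁, |ω ε - 1 + ε * Ω / 2| ≤ C₁ * ε ^ 2
  harm_bound : ∀ ε ∈ Set.Ioo 0 ε₁,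
    ‖(A ε).harm 0‖ + ‖(A ε).harm 1 - A₀‖ + ∑' m : ℕ, ‖(A ε).harm (m + 2)‖ ≤ C₁ * ε

/-- The Floquet spectral problem of the breather `A` in Fourier coefficients, with eigenvalue
`lam` and eigenvector `B`. -/
structure IsFloquetEigenpair {d : ℕ} (p : ℕ) (ε ω : ℝ) (A : X2 d) (lam : ℂ) (B : X2 d) :
    Prop where
  ne_zero : B ≠ 0
  eq : ∀ (m : ℤ) (n : Fin d → ℤ),
    (1 + (lam + Complex.I * m * ω) ^ 2) * B.harm m n
      + (ε : ℂ) * (1 + 2 * p) / (2 * Real.pi) * (∫ τ in (-Real.pi)..Real.pi,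
          profile A n τ ^ (2 * p) * profile B n τ * Complex.exp (-(Complex.I * m * τ)))
      = (ε : ℂ) * lap (B.harm m) n

end KGBreather

end

/-!
At `ε = 0` the Floquet problem degenerates in the resonant rows `m = ±1`, where the symbol `1 - m²`
vanishes. Dividing these two rows by `ε` and writing `λ = ε η` gives a family of bounded operators
that is analytic up to `ε = 0`. Its limit there is invertible off resonance, and on the rows
`m = ±1` it is conjugate to `𝒥ℋ''(A₀) - 2 η`. A simple isolated eigenvalue `2 Λ` makes this operator
bijective once it is bordered by the eigenvector and a functional, so the implicit function theorem
yields the branch `(λ, B)` together with its uniqueness. The same rescaling gives the breathers: on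
the sequences that are even in `m`, the linearization at the soliton reduces to `L₊`, and the
uniqueness in the implicit function theorem makes the solutions real.
-/

noncomputable section

namespace KGBreather

section FunctionalAnalysis

theorem bijOn_of_comm_square {R X Z V W : Type*} [Ring R] [AddCommGroup X] [Module R X]
    [AddCommGroup Z] [Module R Z] [AddCommGroup V] [Module R V] [AddCommGroup W] [Module R W]
    {T : X →ₗ[R] Z} {M : V →ₗ[R] W} {r : V →ₗ[R] X} {s : W →ₗ[R] Z} {X' : Submodule R X}
    {Z' : Submodule R Z} (hT : Set.MapsTo T X' Z') (hr : ∀ v, r v ∈ X')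
    (hs : Function.Injective s) (hcomm : ∀ v, T (r v) = s (M v)) (hM : Function.Bijective M)
    (hker : ∀ x ∈ X', T x ∈ Set.range s → x ∈ Set.range r)
    (hcoker : ∀ z ∈ Z', ∃ x ∈ X', z - T x ∈ Set.range s) : Set.BijOn T X' Z' := by
  refine ⟨hT, fun x hx y hy hxy => ?_, fun z hz => ?_⟩
  · obtain ⟨v, hv⟩ := hker (x - y) (X'.sub_mem hx hy) ⟨0, by rw [map_zero, map_sub, hxy, sub_self]⟩
    have hMv : M v = 0 := hs (by rw [← hcomm, hv, map_sub, hxy, sub_self, map_zero])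
    rw [← sub_eq_zero, ← hv, hM.1 (hMv.trans (map_zero M).symm), map_zero]
  · obtain ⟨x, hx, w, hw⟩ := hcoker z hz
    obtain ⟨v, rfl⟩ := hM.2 w
    exact ⟨x + r v, X'.add_mem hx (hr v), by rw [map_add, hcomm, hw, add_sub_cancel]⟩

theorem isUnit_mul_sub_algebraMap {R : Type*} [Ring R] [Algebra ℂ R] {J D : R} {z : ℂ}
    (hJ : J * J = -1) (hJD : Commute J D) (hp : IsUnit (D + algebraMap ℂ R (Complex.I * z)))
    (hm : IsUnit (D - algebraMap ℂ R (Complex.I * z))) : IsUnit (J * D - algebraMap ℂ R z) := by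
  have hcomm (w : ℂ) (a : R) : Commute (algebraMap ℂ R w) a := Algebra.commutes w a
  have hfactor : (J * D - algebraMap ℂ R z) * (J * D + algebraMap ℂ R z)
      = -((D + algebraMap ℂ R (Complex.I * z)) * (D - algebraMap ℂ R (Complex.I * z))) := by
    rw [← (hcomm z _).symm.mul_self_sub_mul_self_eq', ← (hcomm _ D).symm.mul_self_sub_mul_self_eq,
      ← map_mul, ← map_mul, hJD.symm.mul_mul_mul_comm, hJ, mul_mul_mul_comm, Complex.I_mul_I]
    simp only [neg_mul, one_mul, map_neg, sub_neg_eq_add, neg_add']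
  have hJDz : Commute (J * D - algebraMap ℂ R z) (J * D + algebraMap ℂ R z) :=
    ((Commute.refl (J * D)).add_right (hcomm z _).symm).sub_left
      ((hcomm z _).add_right (hcomm z _))
  exact (hJDz.isUnit_mul_iff.mp (hfactor ▸ (hp.mul hm).neg)).1

section Bordered

variable {𝕜 E F : Type*} [NontriviallyNormedField 𝕜] [NormedAddCommGroup E] [NormedSpace 𝕜 E]
  [NormedAddCommGroup F] [NormedSpace 𝕜 F]

/-- The operator `T` bordered by the column `z` and the row `φ`, that is, the operator with block
matrix `[[T, z], [φ, 0]]`. Bordering a Fredholm operator of index `0` with one-dimensional kernel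
makes it invertible, so that its kernel can be followed under perturbations. -/
def borderedOp (T : E →L[𝕜] F) (z : F) (φ : E →L[𝕜] 𝕜) : E × 𝕜 →L[𝕜] F × 𝕜 :=
  (T.coprod (ContinuousLinearMap.toSpanSingleton 𝕜 z)).prod (φ ∘L ContinuousLinearMap.fst 𝕜 E 𝕜)

@[simp]
theorem borderedOp_apply (T : E →L[𝕜] F) (z : F) (φ : E →L[𝕜] 𝕜) (x : E × 𝕜) :
    borderedOp T z φ x = (T x.1 + x.2 • z, φ x.1) := rfl

theorem analyticAt_borderedOp (z : F) (φ : E →L[𝕜] 𝕜) (T : E →L[𝕜] F) :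
    AnalyticAt 𝕜 (fun T => borderedOp T z φ) T := by
  let A : (E →L[𝕜] F) →L[𝕜] E × 𝕜 →L[𝕜] F × 𝕜 :=
    (ContinuousLinearMap.inl 𝕜 F 𝕜).postcomp (E × 𝕜) ∘L (ContinuousLinearMap.fst 𝕜 E 𝕜).precomp F
  have h : (fun T => borderedOp T z φ) = fun T => borderedOp 0 z φ + A T := by
    ext T x <;> simp [A]
  rw [h]
  exact analyticAt_const.add (A.analyticAt T)

theorem eq_smul_of_borderedOp_eq {T : E →L[𝕜] F} {z : F} {φ : E →L[𝕜] 𝕜}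
    (hinj : Function.Injective (borderedOp T z φ)) {q : E × 𝕜}
    (hq : borderedOp T z φ q = (0, 1)) {x : E} (hx : T x = 0) :
    x = φ x • q.1 ∧ φ x * q.2 = 0 := by
  have h : (x, (0 : 𝕜)) = φ x • q := hinj (by rw [map_smul, hq]; simp [hx])
  exact ⟨congrArg Prod.fst h, (congrArg Prod.snd h).symm⟩

theorem bijective_borderedOp {T : E →L[𝕜] F} {z : F} {φ : E →L[𝕜] 𝕜} {f : E} (hTf : T f = 0)
    (hφf : φ f = 1) (hbij : Function.Bijective (T + φ.smulRight z)) :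
    Function.Bijective (borderedOp T z φ) := by
  have hf : (T + φ.smulRight z) f = z := by simp [hTf, hφf]
  constructor
  · rw [injective_iff_map_eq_zero]
    rintro ⟨x, s⟩ h
    obtain ⟨hx, hφx⟩ : T x + s • z = 0 ∧ φ x = 0 := by simpa using h
    have hxf : x = -(s • f) := hbij.1 <| by
      rw [map_neg, map_smul, hf]
      simpa [hφx] using eq_neg_of_add_eq_zero_left hx
    obtain rfl : s = 0 := by simpa [hxf, hφf] using hφx
    simp [hxf]
  · rintro ⟨w, t⟩
    obtain ⟨x, hx⟩ := hbij.2 w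
    refine ⟨(x + (t - φ x) • f, φ x), ?_⟩
    simpa [hTf, hφf] using hx

theorem isUnit_add_of_isCompactOperator [CompleteSpace E] {S K : E →L[𝕜] E} (hS : IsUnit S)
    (hK : IsCompactOperator K) (hinj : ∀ x, (S + K) x = 0 → x = 0) : IsUnit (S + K) := by
  obtain ⟨u, rfl⟩ := hS
  have hfactor : (u : E →L[𝕜] E) + K = u * (1 - -(↑u⁻¹ * K)) := by
    rw [sub_neg_eq_add, mul_add, mul_one, Units.mul_inv_cancel_left]
  rw [hfactor]
  refine u.isUnit.mul ?_
  have hcompact : IsCompactOperator (-((↑u⁻¹ : E →L[𝕜] E) * K)) := (hK.clm_comp _).neg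
  rcases hcompact.hasEigenvalue_or_mem_resolventSet (one_ne_zero (α := 𝕜)) with h | h
  · obtain ⟨x, hx⟩ := h.exists_hasEigenvector
    refine absurd (hinj x ?_) hx.2
    have hneg : -((↑u⁻¹ : E →L[𝕜] E) * K) x = x := by simpa using hx.apply_eq_smul
    rw [hfactor, mul_apply_eq_comp, sub_apply, one_apply_eq_self]
    rw [neg_apply, hneg, sub_self, map_zero]
  · simpa [resolventSet] using h

theorem exists_eq_smul_of_simple_eigenvalue {R M : Type*} [Field R] [AddCommGroup M]
    [Module R M] {T : Module.End R M} {μ : R} {f : M} (hf : T.HasEigenvector μ f)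
    (hsimple : Module.finrank R (T.maxGenEigenspace μ) = 1) {x : M} {c : R}
    (hx : T x - μ • x = c • f) : ∃ a : R, x = a • f := by
  have hmem : ∀ y : M, ∀ c : R, T y - μ • y = c • f → y ∈ T.maxGenEigenspace μ := by
    intro y c hy
    refine Module.End.mem_maxGenEigenspace T μ y |>.mpr ⟨2, ?_⟩
    have hsub : (T - μ • 1) y = c • f := hy
    rw [pow_two, Module.End.mul_apply, hsub, map_smul]
    simp [hf.apply_eq_smul]
  have hfmem := hmem f 0 (by simp [hf.apply_eq_smul])
  obtain ⟨a, ha⟩ := (finrank_eq_one_iff_of_nonzero' (⟨f, hfmem⟩ : T.maxGenEigenspace μ)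
    fun h => hf.2 (congrArg Subtype.val h)).mp hsimple ⟨x, hmem x c hx⟩
  exact ⟨a, (congrArg Subtype.val ha).symm⟩

theorem bijective_borderedOp_of_simple_eigenvalue [LocallyCompactSpace 𝕜] [CompleteSpace E]
    {T S K : E →L[𝕜] E} {μ : 𝕜} (hT : T - μ • 1 = S + K) (hS : IsUnit S)
    (hK : IsCompactOperator K) {f : E} (hf : Module.End.HasEigenvector (T : Module.End 𝕜 E) μ f)
    (hsimple : Module.finrank 𝕜 (Module.End.maxGenEigenspace (T : Module.End 𝕜 E) μ) = 1)
    {φ : E →L[𝕜] 𝕜} (hφf : φ f = 1) {c : 𝕜} (hc : c ≠ 0) :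
    Function.Bijective (borderedOp (T - μ • 1) (c • f) φ) := by
  have hTf : T f = μ • f := hf.apply_eq_smul
  refine bijective_borderedOp (f := f) (by simp [hTf]) hφf ?_
  have hrank : IsCompactOperator (φ.smulRight (c • f)) :=
    (isCompactOperator_of_locallyCompactSpace_dom φ).clm_comp
      (ContinuousLinearMap.toSpanSingleton 𝕜 (c • f))
  rw [← ContinuousLinearMap.isUnit_iff_bijective, hT, add_assoc]
  refine isUnit_add_of_isCompactOperator hS (hK.add hrank) fun x hx => ?_
  rw [← add_assoc, ← hT] at hx
  have hsum : T x - μ • x + φ x • c • f = 0 := by simpa using hx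
  have hTx : T x - μ • x = -(φ x * c) • f := by
    rw [neg_smul, mul_smul]
    exact eq_neg_of_add_eq_zero_left hsum
  obtain ⟨a, rfl⟩ := exists_eq_smul_of_simple_eigenvalue hf hsimple hTx
  have ha : (a * c) • f = 0 := by simpa [hTf, hφf, smul_comm a μ, mul_smul] using hsum
  simp [((smul_eq_zero.mp ha).resolve_right hf.2 |> mul_eq_zero.mp).resolve_right hc]

end Bordered

section Inverse

variable {𝕜 X E : Type*} [NontriviallyNormedField 𝕜] [NormedAddCommGroup E] [NormedSpace 𝕜 E]

theorem bijective_comp_add_id_sub {L P : E →L[𝕜] E} (hP : ∀ y, P (P y) = P y)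
    (hbij : Set.BijOn L {y | P y = y} {y | P y = y}) :
    Function.Bijective (L ∘L P + (.id 𝕜 E - P) : E →L[𝕜] E) := by
  have hPL (y : E) : P (L (P y)) = L (P y) := hbij.mapsTo (hP y)
  constructor
  · rw [injective_iff_map_eq_zero]
    intro y hy
    have hsum : L (P y) + (y - P y) = 0 := hy
    have hLPy : L (P y) = 0 := by simpa [hPL, hP] using congrArg P hsum
    have hPy : P y = 0 := hbij.injOn (hP y) (map_zero P) (by rw [hLPy, map_zero])
    simpa [hPy] using hsum
  · intro z
    obtain ⟨y, hy, hLy⟩ := hbij.surjOn (hP z)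
    rw [Set.mem_ofPred_eq] at hy
    refine ⟨y + (z - P z), ?_⟩
    have hPy : P (y + (z - P z)) = y := by simp [hy, hP]
    change L (P (y + (z - P z))) + (y + (z - P z) - P (y + (z - P z))) = z
    rw [hPy, hLy]
    abel

theorem analyticAt_inverse_apply [CompleteSpace E] [NormedAddCommGroup X] [NormedSpace 𝕜 X]
    {M : X → E →L[𝕜] E} {x₀ : X} (hM : AnalyticAt 𝕜 M x₀)
    (hbij : Function.Bijective (M x₀)) (z : E) :
    AnalyticAt 𝕜 (fun x => Ring.inverse (M x) z) x₀ := by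
  obtain ⟨u, hu⟩ := ContinuousLinearMap.isUnit_iff_bijective.mpr hbij
  have hinv : AnalyticAt 𝕜 Ring.inverse (M x₀) := hu ▸ analyticAt_inverse u
  exact ((ContinuousLinearMap.apply 𝕜 E z).analyticAt _).comp (hinv.comp hM)

theorem eventually_injective_and_apply_inverse [CompleteSpace E] [TopologicalSpace X]
    {M : X → E →L[𝕜] E} {x₀ : X} (hM : ContinuousAt M x₀) (hbij : Function.Bijective (M x₀))
    (z : E) :
    ∀ᶠ x in 𝓝 x₀, Function.Injective (M x) ∧ M x (Ring.inverse (M x) z) = z := by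
  have hunit : IsUnit (M x₀) := ContinuousLinearMap.isUnit_iff_bijective.mpr hbij
  filter_upwards [hM.eventually (Units.isOpen.mem_nhds hunit)] with x (hx : IsUnit (M x))
  exact ⟨(ContinuousLinearMap.isUnit_iff_bijective.mp hx).1,
    congrArg (fun T : E →L[𝕜] E => T z) (Ring.mul_inverse_cancel _ hx)⟩

end Inverse

section ImplicitFunction

variable {𝕜 Θ Y Z : Type*} [RCLike 𝕜] [NormedAddCommGroup Θ] [NormedSpace 𝕜 Θ] [CompleteSpace Θ]
  [NormedAddCommGroup Y] [NormedSpace 𝕜 Y] [CompleteSpace Y]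
  [NormedAddCommGroup Z] [NormedSpace 𝕜 Z] [CompleteSpace Z]

theorem exists_implicitFunction {F : Θ × Y → Z} {θ₀ : Θ} {y₀ : Y}
    (hF : AnalyticAt 𝕜 F (θ₀, y₀)) (h0 : F (θ₀, y₀) = 0) {F₂ : Y →L[𝕜] Z}
    (hF₂ : HasFDerivAt (fun y => F (θ₀, y)) F₂ y₀) (hbij : Function.Bijective F₂) :
    ∃ ψ : Θ → Y, AnalyticAt 𝕜 ψ θ₀ ∧ ψ θ₀ = y₀ ∧ ∀ᶠ v in 𝓝 (θ₀, y₀), F v = 0 ↔ ψ v.1 = v.2 := by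
  have hcd : ContDiffAt 𝕜 ⊤ F (θ₀, y₀) := hF.contDiffAt
  have hpartial : fderiv 𝕜 F (θ₀, y₀) ∘L ContinuousLinearMap.inr 𝕜 Θ Y = F₂ :=
    (hF.differentiableAt.hasFDerivAt.comp y₀ (hasFDerivAt_prodMk_right θ₀ y₀)).unique hF₂
  have hinv : (fderiv 𝕜 F (θ₀, y₀) ∘L ContinuousLinearMap.inr 𝕜 Θ Y).IsInvertible := by
    rw [hpartial]
    exact ⟨ContinuousLinearEquiv.ofBijective F₂ (LinearMap.ker_eq_bot.mpr hbij.1)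
      (LinearMap.range_eq_top.mpr hbij.2), ContinuousLinearEquiv.coe_ofBijective _ _ _⟩
  have htop : (⊤ : WithTop ℕ∞) ≠ 0 := by simp
  exact ⟨hcd.implicitFunction htop hinv, (hcd.contDiffAt_implicitFunction htop hinv).analyticAt,
    hcd.implicitFunction_apply_self htop hinv,
    by simpa only [h0] using hcd.eventually_apply_eq_iff_implicitFunction htop hinv⟩

/-
For an idempotent `P`, the equation `G (θ, P y) + (y - P y) = 0` says that `y` lies in the range of
`P` and solves `G (θ, y) = 0`.
-/
theorem exists_implicitFunction_on_range {G : Θ × Y → Y} {P : Y →L[𝕜] Y}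
    (hP : ∀ y, P (P y) = P y) (hGP : ∀ θ y, P (G (θ, P y)) = G (θ, P y)) {θ₀ : Θ} {y₀ : Y}
    (hG : AnalyticAt 𝕜 G (θ₀, y₀)) (h0 : G (θ₀, y₀) = 0) (hy₀ : P y₀ = y₀) {L : Y →L[𝕜] Y}
    (hL : HasFDerivAt (fun y => G (θ₀, y)) L y₀)
    (hbij : Set.BijOn L {y | P y = y} {y | P y = y}) :
    ∃ ψ : Θ → Y, AnalyticAt 𝕜 ψ θ₀ ∧ ψ θ₀ = y₀ ∧
      ∀ᶠ v in 𝓝 (θ₀, y₀), P v.2 = v.2 ∧ G v = 0 ↔ ψ v.1 = v.2 := by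
  let F : Θ × Y → Y := fun v => G (v.1, P v.2) + (v.2 - P v.2)
  have hF_iff (v : Θ × Y) : F v = 0 ↔ P v.2 = v.2 ∧ G v = 0 := by
    refine ⟨fun h => ?_, fun ⟨hv, hGv⟩ => by simp [F, hv, hGv]⟩
    have hPF : P (F v) = G (v.1, P v.2) := by simp [F, hGP, hP]
    rw [h, map_zero] at hPF
    have hv : P v.2 = v.2 := by
      simpa only [F, ← hPF, zero_add, sub_eq_zero, eq_comm (a := v.2)] using h
    exact ⟨hv, by rw [hPF, hv]⟩
  have hF : AnalyticAt 𝕜 F (θ₀, y₀) := by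
    have hPan : AnalyticAt 𝕜 (fun v : Θ × Y => (v.1, P v.2)) (θ₀, y₀) :=
      analyticAt_fst.prod (P.analyticAt _ |>.comp analyticAt_snd)
    refine (AnalyticAt.comp (by simpa only [hy₀] using hG) hPan).add ?_
    exact analyticAt_snd.sub (P.analyticAt _ |>.comp analyticAt_snd)
  have hF₂ : HasFDerivAt (fun y => F (θ₀, y)) (L ∘L P + (.id 𝕜 Y - P)) y₀ :=
    (HasFDerivAt.comp (g := fun y => G (θ₀, y)) y₀ (by rwa [hy₀]) P.hasFDerivAt).fun_add
      ((hasFDerivAt_id y₀).fun_sub P.hasFDerivAt)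
  obtain ⟨ψ, hψ, hψ0, hiff⟩ :=
    exists_implicitFunction hF ((hF_iff _).mpr ⟨hy₀, h0⟩) hF₂
      (bijective_comp_add_id_sub hP hbij)
  exact ⟨ψ, hψ, hψ0, by simpa only [hF_iff] using hiff⟩

theorem exists_kernel_branch {L : Θ × 𝕜 → Y →L[𝕜] Y} {θ₀ : Θ} (hL : AnalyticAt 𝕜 L (θ₀, 0))
    {L₀ N : Y →L[𝕜] Y} (hLN : ∀ ν, L (θ₀, ν) = L₀ + ν • N) {y₀ : Y} (hy₀ : L₀ y₀ = 0)
    {φ : Y →L[𝕜] 𝕜} (hφ : φ y₀ = 1) (hbij : Function.Bijective (borderedOp L₀ (N y₀) φ)) :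
    ∃ (ν : Θ → 𝕜) (v : Θ → Y), AnalyticAt 𝕜 ν θ₀ ∧ AnalyticAt 𝕜 v θ₀ ∧ ν θ₀ = 0 ∧ v θ₀ = y₀ ∧
      (∀ᶠ θ in 𝓝 θ₀, v θ ≠ 0 ∧ L (θ, ν θ) (v θ) = 0) ∧
      ∀ᶠ x in 𝓝 (θ₀, (0 : 𝕜)), ∀ D ≠ 0, L x D = 0 → x.2 = ν x.1 ∧ ∃ c : 𝕜, D = c • v x.1 := by
  let M : Θ × 𝕜 → Y × 𝕜 →L[𝕜] Y × 𝕜 := fun x => borderedOp (L x) (N y₀) φ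
  let Q : Θ × 𝕜 → Y × 𝕜 := fun x => Ring.inverse (M x) (0, 1)
  have hM : AnalyticAt 𝕜 M (θ₀, 0) := (analyticAt_borderedOp (N y₀) φ _).comp hL
  have hMbij : Function.Bijective (M (θ₀, 0)) := by simpa [M, hLN] using hbij
  have hQ : AnalyticAt 𝕜 Q (θ₀, 0) := analyticAt_inverse_apply hM hMbij (0, 1)
  have hMQ : ∀ᶠ x in 𝓝 (θ₀, (0 : 𝕜)), Function.Injective (M x) ∧ M x (Q x) = (0, 1) :=
    eventually_injective_and_apply_inverse hM.continuousAt hMbij (0, 1)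
  have hQ₀ : ∀ᶠ ν in 𝓝 (0 : 𝕜), Q (θ₀, ν) = (y₀, -ν) := by
    filter_upwards [(Continuous.prodMk_right θ₀).continuousAt.eventually hMQ] with ν ⟨hinj, hν⟩
    refine hinj (hν.trans ?_)
    simp [M, hLN, hy₀, hφ]
  have hderiv : HasFDerivAt (fun ν => (Q (θ₀, ν)).2) (-.id 𝕜 𝕜 : 𝕜 →L[𝕜] 𝕜) 0 := by
    refine (hasFDerivAt_id (0 : 𝕜)).neg.congr_of_eventuallyEq ?_
    filter_upwards [hQ₀] with ν hν
    simp [hν]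
  obtain ⟨ν, hν, hν0, hiff⟩ := exists_implicitFunction (F := fun x => (Q x).2)
    (analyticAt_snd.comp hQ) (by simp [hQ₀.self_of_nhds]) hderiv (Equiv.neg 𝕜).bijective
  have hpath : AnalyticAt 𝕜 (fun θ => (θ, ν θ)) θ₀ := analyticAt_id.prod hν
  have hpath0 : Filter.Tendsto (fun θ => (θ, ν θ)) (𝓝 θ₀) (𝓝 (θ₀, 0)) := by
    simpa [ContinuousAt, hν0] using hpath.continuousAt
  refine ⟨ν, fun θ => (Q (θ, ν θ)).1, hν, ?_, hν0, by simp [hν0, hQ₀.self_of_nhds], ?_, ?_⟩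
  · have hQν : AnalyticAt 𝕜 Q (θ₀, ν θ₀) := by rwa [hν0]
    exact analyticAt_fst.comp (hQν.comp (f := fun θ => (θ, ν θ)) hpath)
  · filter_upwards [hpath0.eventually hMQ, hpath0.eventually hiff] with θ ⟨_, hθ⟩ hθν
    have hS : (Q (θ, ν θ)).2 = 0 := hθν.mpr rfl
    simp only [M, borderedOp_apply, hS, zero_smul, add_zero, Prod.mk.injEq] at hθ
    exact ⟨fun h => by simp [h] at hθ, hθ.1⟩
  · filter_upwards [hMQ, hiff] with x ⟨hinj, hx⟩ hxν D hD hLD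
    obtain ⟨hDQ, hS⟩ := eq_smul_of_borderedOp_eq hinj hx hLD
    have hφD : φ D ≠ 0 := fun h => hD (by rw [hDQ, h, zero_smul])
    have hνx : ν x.1 = x.2 := hxν.mp ((mul_eq_zero.mp hS).resolve_left hφD)
    exact ⟨hνx.symm, φ D, by simpa [hνx] using hDQ⟩

end ImplicitFunction

end FunctionalAnalysis

section SequenceSpaces

variable {ι κ : Type*} {E F : Type*} [NormedAddCommGroup E] [NormedSpace ℂ E]
  [NormedAddCommGroup F] [NormedSpace ℂ F]

/-- Componentwise multiplication by a bounded scalar sequence `a` on `ℓ²(ι; E)`. The bound `K` is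
an argument so that the operator norm is controlled by it. -/
def multOp (a : ι → ℂ) {K : ℝ} (hK : 0 ≤ K) (ha : ∀ i, ‖a i‖ ≤ K) :
    lp (fun _ : ι => E) 2 →L[ℂ] lp (fun _ : ι => E) 2 :=
  lp.mapCLM 2 (fun i => a i • ContinuousLinearMap.id ℂ E) hK fun i => by
    rw [norm_smul]
    exact (mul_le_of_le_one_right (norm_nonneg _) ContinuousLinearMap.norm_id_le).trans (ha i)

@[simp] theorem multOp_apply (a : ι → ℂ) {K : ℝ} (hK : 0 ≤ K) (ha : ∀ i, ‖a i‖ ≤ K)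
    (y : lp (fun _ : ι => E) 2) (i : ι) : multOp a hK ha y i = a i • y i := by
  simp [multOp]

theorem norm_multOp_le (a : ι → ℂ) {K : ℝ} (hK : 0 ≤ K) (ha : ∀ i, ‖a i‖ ≤ K) :
    ‖(multOp a hK ha : lp (fun _ : ι => E) 2 →L[ℂ] lp (fun _ : ι => E) 2)‖ ≤ K :=
  lp.norm_mapCLM_le 2 _ _ _

/-- The operator `ℓ²(ι; E) → ℓ²(ι; F)` that acts as `T` on each component. -/
def diagOp (T : E →L[ℂ] F) : lp (fun _ : ι => E) 2 →L[ℂ] lp (fun _ : ι => F) 2 :=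
  lp.mapCLM 2 (fun _ => T) (norm_nonneg T) (fun _ => le_rfl)

@[simp] theorem diagOp_apply (T : E →L[ℂ] F) (y : lp (fun _ : ι => E) 2) (i : ι) :
    diagOp T y i = T (y i) := by
  simp [diagOp]

theorem norm_diagOp_le (T : E →L[ℂ] F) :
    ‖(diagOp T : lp (fun _ : ι => E) 2 →L[ℂ] lp (fun _ : ι => F) 2)‖ ≤ ‖T‖ :=
  lp.norm_mapCLM_le 2 _ _ _

/-- The operator `ℓ²(κ; E) → ℓ²(ι; E)` that relabels the components along a bijection. -/
def reindexOp (e : ι ≃ κ) : lp (fun _ : κ => E) 2 →L[ℂ] lp (fun _ : ι => E) 2 :=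
  LinearMap.mkContinuous
    { toFun := fun y => ⟨fun i => y (e i),
        memℓp_gen (((lp.memℓp y).summable (by norm_num)).comp_injective e.injective)⟩
      map_add' := fun _ _ => rfl
      map_smul' := fun _ _ => rfl }
    1
    (fun y => by
      have h2 : 0 < (2 : ENNReal).toReal := by norm_num
      rw [one_mul]
      refine lp.norm_le_of_tsum_le h2 (norm_nonneg _) ?_
      rw [lp.norm_rpow_eq_tsum h2 y]
      exact (e.tsum_eq (fun k => ‖y k‖ ^ (2 : ENNReal).toReal)).le)

theorem norm_reindexOp_le (e : ι ≃ κ) :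
    ‖(reindexOp e : lp (fun _ : κ => E) 2 →L[ℂ] lp (fun _ : ι => E) 2)‖ ≤ 1 :=
  LinearMap.mkContinuous_norm_le _ zero_le_one _

/-- The pointwise product of `ℓ²(ι)` as a bounded bilinear map. -/
def mulOp (ι : Type*) :
    lp (fun _ : ι => ℂ) 2 →L[ℂ] lp (fun _ : ι => ℂ) 2 →L[ℂ] lp (fun _ : ι => ℂ) 2 :=
  LinearMap.mkContinuous
    { toFun := fun f => multOp f (norm_nonneg f) (lp.norm_apply_le_norm two_ne_zero f)
      map_add' := fun f g => by
        ext h i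
        exact add_mul (f i) (g i) (h i)
      map_smul' := fun c f => by
        ext h i
        exact mul_assoc c (f i) (h i) }
    1 (fun f => (norm_multOp_le f (norm_nonneg f)
      (lp.norm_apply_le_norm two_ne_zero f)).trans_eq (one_mul _).symm)

@[simp] theorem mulOp_apply (f g : lp (fun _ : ι => ℂ) 2) (i : ι) :
    mulOp ι f g i = f i * g i :=
  multOp_apply f (norm_nonneg f) (lp.norm_apply_le_norm two_ne_zero f) g i

theorem norm_mulOp_le (f : lp (fun _ : ι => ℂ) 2) : ‖mulOp ι f‖ ≤ ‖f‖ :=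
  norm_multOp_le f (norm_nonneg f) (lp.norm_apply_le_norm two_ne_zero f)

theorem mulOp_pow_apply (f g : lp (fun _ : ι => ℂ) 2) (k : ℕ) (i : ι) :
    (mulOp ι f ^ k) g i = f i ^ k * g i := by
  induction k with
  | zero => simp
  | succ k ih =>
    rw [pow_succ', mul_apply_eq_comp, mulOp_apply, ih, pow_succ', mul_assoc]

theorem isCompactOperator_mulOp_single [DecidableEq ι] (i : ι) (c : ℂ) :
    IsCompactOperator (mulOp ι (lp.single 2 i c)) := by
  have factor : mulOp ι (lp.single 2 i c)
      = (c • lp.singleContinuousLinearMap ℂ (fun _ : ι => ℂ) 2 i).comp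
        (lp.evalCLM ℂ (fun _ : ι => ℂ) 2 i) := by
    ext f j
    have h : mulOp ι (lp.single 2 i c) f j = (Pi.single i c : ι → ℂ) j * f j := mulOp_apply _ _ _
    rw [h]
    change _ = c • (Pi.single i (f i) : ι → ℂ) j
    by_cases hj : j = i
    · subst hj; simp
    · simp [hj]
  rw [factor]
  exact (isCompactOperator_of_locallyCompactSpace_rng
    (c • lp.singleContinuousLinearMap ℂ (fun _ : ι => ℂ) 2 i)).comp_clm _

theorem isCompactOperator_mulOp (f : lp (fun _ : ι => ℂ) 2) : IsCompactOperator (mulOp ι f) := by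
  classical
  have hsum := (mulOp ι).hasSum (lp.hasSum_single (by norm_num : (2 : ENNReal) ≠ ⊤) f)
  refine isCompactOperator_of_tendsto hsum (Filter.Eventually.of_forall fun s => ?_)
  exact Finset.sum_induction _
    (fun T : lp (fun _ : ι => ℂ) 2 →L[ℂ] lp (fun _ : ι => ℂ) 2 => IsCompactOperator T)
    (fun _ _ ha hb => ha.add hb) isCompactOperator_zero
    (fun i _ => isCompactOperator_mulOp_single i (f i))

end SequenceSpaces

section FourierSeries

theorem norm_exp_I_mul_int_mul (m : ℤ) (τ : ℝ) : ‖Complex.exp (Complex.I * m * τ)‖ = 1 := by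
  have h : Complex.I * m * τ = ((m * τ : ℝ) : ℂ) * Complex.I := by push_cast; ring
  rw [h, Complex.norm_exp_ofReal_mul_I]

theorem integral_exp_I_mul_int_mul (k : ℤ) :
    ∫ τ in (-Real.pi)..Real.pi, Complex.exp (Complex.I * k * τ)
      = if k = 0 then 2 * (Real.pi : ℂ) else 0 := by
  split_ifs with h
  · subst h
    simp
    ring
  · have hk : Complex.I * k ≠ 0 := mul_ne_zero Complex.I_ne_zero (by exact_mod_cast h)
    rw [integral_exp_mul_complex hk, div_eq_zero_iff, sub_eq_zero,
      Complex.exp_eq_exp_iff_exists_int]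
    refine Or.inl ⟨k, ?_⟩
    push_cast
    ring

/-- The change of variables `(m, k) ↦ (k, m - k)` of the Cauchy product over `ℤ`. -/
def convEquiv : ℤ × ℤ ≃ ℤ × ℤ where
  toFun x := (x.2, x.1 - x.2)
  invFun x := (x.1 + x.2, x.1)
  left_inv x := by simp
  right_inv x := by simp

variable {a c : ℤ → ℂ}

theorem summable_norm_mul_sub (ha : Summable fun k => ‖a k‖) (hc : Summable fun k => ‖c k‖) :
    Summable fun x : ℤ × ℤ => ‖a x.2 * c (x.1 - x.2)‖ :=
  (convEquiv.summable_iff (f := fun x : ℤ × ℤ => ‖a x.1 * c x.2‖)).mpr (ha.mul_norm hc)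

theorem summable_norm_convolution (ha : Summable fun k => ‖a k‖)
    (hc : Summable fun k => ‖c k‖) : Summable fun m => ‖∑' k, a k * c (m - k)‖ :=
  have h := summable_norm_mul_sub ha hc
  Summable.of_nonneg_of_le (fun _ => norm_nonneg _)
    (fun m => norm_tsum_le_tsum_norm (h.prod_factor m)) h.prod

theorem tsum_mul_tsum_eq_tsum_convolution (ha : Summable fun k => ‖a k‖)
    (hc : Summable fun k => ‖c k‖) :
    (∑' k, a k) * ∑' k, c k = ∑' m, ∑' k, a k * c (m - k) := by
  rw [tsum_mul_tsum_of_summable_norm ha hc, ← convEquiv.tsum_eq]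
  exact (summable_norm_mul_sub ha hc).of_norm.tsum_prod

/-- The sum of the Fourier series with coefficients `c`. -/
def fourierSum (c : ℤ → ℂ) (τ : ℝ) : ℂ := ∑' m : ℤ, c m * Complex.exp (Complex.I * m * τ)

theorem fourierSum_convolution (ha : Summable fun k => ‖a k‖) (hc : Summable fun k => ‖c k‖)
    (τ : ℝ) :
    fourierSum (fun m => ∑' k, a k * c (m - k)) τ = fourierSum a τ * fourierSum c τ := by
  have summable_term {b : ℤ → ℂ} (hb : Summable fun k => ‖b k‖) :
      Summable fun k : ℤ => ‖b k * Complex.exp (Complex.I * k * τ)‖ := by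
    simpa only [norm_mul, norm_exp_I_mul_int_mul, mul_one] using hb
  have exp_split (m k : ℤ) : Complex.exp (Complex.I * m * τ)
      = Complex.exp (Complex.I * k * τ) * Complex.exp (Complex.I * (m - k : ℤ) * τ) := by
    rw [← Complex.exp_add]
    congr 1
    push_cast
    ring
  unfold fourierSum
  rw [tsum_mul_tsum_eq_tsum_convolution (summable_term ha) (summable_term hc)]
  refine tsum_congr fun m => ?_
  rw [← tsum_mul_right]
  refine tsum_congr fun k => ?_
  rw [exp_split m k]
  ring

theorem integral_fourierSum_mul_exp (hc : Summable fun k => ‖c k‖) (m : ℤ) :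
    ∫ τ in (-Real.pi)..Real.pi, fourierSum c τ * Complex.exp (-(Complex.I * m * τ))
      = 2 * (Real.pi : ℂ) * c m := by
  let term : ℤ → C(ℝ, ℂ) := fun k =>
    ⟨fun τ => c k * Complex.exp (Complex.I * (k - m : ℤ) * τ), by fun_prop⟩
  have summable_term : Summable fun k => ‖(term k).restrict
      (⟨Set.uIcc (-Real.pi) Real.pi, isCompact_uIcc⟩ : TopologicalSpace.Compacts ℝ)‖ := by
    refine Summable.of_nonneg_of_le (fun _ => norm_nonneg _) (fun k => ?_) hc
    refine (ContinuousMap.norm_le _ (norm_nonneg _)).mpr fun x => ?_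
    simp only [term, ContinuousMap.restrict_apply, ContinuousMap.coe_mk]
    rw [norm_mul, norm_exp_I_mul_int_mul, mul_one]
  have tsum_term (τ : ℝ) :
      ∑' k, term k τ = fourierSum c τ * Complex.exp (-(Complex.I * m * τ)) := by
    rw [fourierSum, ← tsum_mul_right]
    refine tsum_congr fun k => ?_
    simp only [term, ContinuousMap.coe_mk]
    rw [mul_assoc (c k), ← Complex.exp_add]
    congr 2
    push_cast
    ring
  have integral_term (k : ℤ) : ∫ τ in (-Real.pi)..Real.pi, term k τ
      = if k = m then 2 * (Real.pi : ℂ) * c m else 0 := by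
    simp only [term, ContinuousMap.coe_mk, intervalIntegral.integral_const_mul,
      integral_exp_I_mul_int_mul, sub_eq_zero]
    split_ifs with hk
    · rw [hk]; ring
    · simp
  have hsum := intervalIntegral.hasSum_intervalIntegral_of_summable_norm summable_term
  simp only [tsum_term, integral_term] at hsum
  exact hsum.unique (hasSum_ite_eq m _)

end FourierSeries

section Harmonics

/-- The space `ℓ²(ℤ; ℓ²(ℤ^d))`, which parametrizes `ℓ^{2,2}(ℤ; ℓ²(ℤ^d))` through
`B^{(m)} = y_m / (1 + m²)`. -/
abbrev Harm (d : ℕ) : Type := lp (fun _ : ℤ => L2Z d) 2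

/-- The inverse `1 / (1 + m²)` of the weight of `ℓ^{2,2}`. -/
def invWeight (m : ℤ) : ℝ := (1 + (m : ℝ) ^ 2)⁻¹

theorem invWeight_pos (m : ℤ) : 0 < invWeight m := by unfold invWeight; positivity

theorem invWeight_neg (m : ℤ) : invWeight (-m) = invWeight m := by simp [invWeight]

theorem invWeight_le_one (m : ℤ) : invWeight m ≤ 1 :=
  inv_le_one_of_one_le₀ (by nlinarith [sq_nonneg (m : ℝ)])

theorem weight_mul_invWeight (m : ℤ) : (1 + (m : ℂ) ^ 2) * (invWeight m : ℂ) = 1 := by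
  have h : (1 + (m : ℝ) ^ 2) * invWeight m = 1 := mul_inv_cancel₀ (by positivity)
  exact_mod_cast h

theorem norm_invWeight (m : ℤ) : ‖(invWeight m : ℂ)‖ = invWeight m := by
  rw [Complex.norm_real, Real.norm_of_nonneg (invWeight_pos m).le]

theorem summable_invWeight : Summable invWeight := by
  have h : Summable fun m : ℤ => 1 / (m : ℝ) ^ 2 := Real.summable_one_div_int_pow.mpr one_lt_two
  refine Summable.of_norm_bounded_eventually h ?_
  filter_upwards [(Set.finite_singleton (0 : ℤ)).compl_mem_cofinite] with m hm
  have hm' : (m : ℝ) ≠ 0 := by exact_mod_cast hm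
  rw [Real.norm_of_nonneg (invWeight_pos m).le, invWeight, ← one_div]
  exact one_div_le_one_div_of_le (by positivity) (by linarith)

variable {d : ℕ}

theorem summable_invWeight_mul_norm (y : Harm d) : Summable fun m => invWeight m * ‖y m‖ :=
  Summable.of_nonneg_of_le (fun m => mul_nonneg (invWeight_pos m).le (norm_nonneg _))
    (fun m => mul_le_mul_of_nonneg_left (lp.norm_apply_le_norm two_ne_zero y m)
      (invWeight_pos m).le)
    (summable_invWeight.mul_right _)

theorem tsum_invWeight_mul_norm_le (y : Harm d) :
    ∑' m, invWeight m * ‖y m‖ ≤ (∑' m, invWeight m) * ‖y‖ := by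
  rw [← tsum_mul_right]
  exact (summable_invWeight_mul_norm y).tsum_le_tsum
    (fun m => mul_le_mul_of_nonneg_left (lp.norm_apply_le_norm two_ne_zero y m)
      (invWeight_pos m).le)
    (summable_invWeight.mul_right _)

/-- The Fourier multiplier `1 / (1 + m²)`, which turns an element of `ℓ²(ℤ; ℓ²(ℤ^d))` into the
harmonics that it parametrizes. -/
def invWeightOp (d : ℕ) : Harm d →L[ℂ] Harm d :=
  multOp (fun m => (invWeight m : ℂ)) zero_le_one
    (fun m => (norm_invWeight m).trans_le (invWeight_le_one m))

@[simp] theorem invWeightOp_apply (y : Harm d) (m : ℤ) :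
    invWeightOp d y m = (invWeight m : ℂ) • y m := multOp_apply _ _ _ _ _

/-- Multiplication by the weight identifies `ℓ^{2,2}(ℤ; ℓ²(ℤ^d))` with `ℓ²(ℤ; ℓ²(ℤ^d))`. -/
def weightEquiv (d : ℕ) : X2 d ≃ₗᵢ[ℂ] Harm d where
  toLinearEquiv := LinearEquiv.ofBijective (X2.weight d) ⟨X2.weight_injective d, fun y => by
    have weight_smul : (fun m : ℤ => (1 + (m : ℂ) ^ 2) • ((invWeight m : ℂ) • y m))
        = fun m => y m := by
      funext m
      rw [smul_smul, weight_mul_invWeight, one_smul]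
    have hm : (fun m : ℤ => (invWeight m : ℂ) • y m) ∈ harmonicsSubmodule d := by
      change Memℓp (fun m : ℤ => (1 + (m : ℂ) ^ 2) • ((invWeight m : ℂ) • y m)) 2
      rw [weight_smul]
      exact lp.memℓp y
    exact ⟨⟨_, hm⟩, lp.ext weight_smul⟩⟩
  norm_map' _ := rfl

theorem harm_eq_invWeightOp (B : X2 d) (m : ℤ) :
    B.harm m = invWeightOp d (weightEquiv d B) m := by
  have h : weightEquiv d B m = (1 + (m : ℂ) ^ 2) • B.harm m := rfl
  rw [invWeightOp_apply, h, smul_smul, mul_comm, weight_mul_invWeight, one_smul]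

theorem harm_weightEquiv_symm (y : Harm d) (m : ℤ) :
    ((weightEquiv d).symm y).harm m = (invWeight m : ℂ) • y m := by
  rw [harm_eq_invWeightOp, LinearIsometryEquiv.apply_symm_apply, invWeightOp_apply]

theorem summable_norm_invWeightOp_apply (y : Harm d) (n : Fin d → ℤ) :
    Summable fun m => ‖invWeightOp d y m n‖ := by
  refine Summable.of_nonneg_of_le (fun _ => norm_nonneg _)
    (fun m => lp.norm_apply_le_norm two_ne_zero (invWeightOp d y m) n) ?_
  simpa only [invWeightOp_apply, norm_smul, norm_invWeight] using summable_invWeight_mul_norm y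

theorem harm_ext {y z : Harm d} (h : ∀ m n, y m n = z m n) : y = z :=
  lp.ext (funext fun m => lp.ext (funext (h m)))

end Harmonics

section Convolution

variable {d : ℕ}

/-- The shift `(y_m) ↦ (y_{m-k})` of harmonics. -/
def shiftHarm (d : ℕ) (k : ℤ) : Harm d →L[ℂ] Harm d := reindexOp (Equiv.subRight k)

@[simp] theorem shiftHarm_apply (k : ℤ) (y : Harm d) (m : ℤ) :
    shiftHarm d k y m = y (m - k) := rfl

/-- The contribution of the harmonic `y_k / (1 + k²)` to a convolution. -/
def convTerm (y : Harm d) (k : ℤ) : Harm d →L[ℂ] Harm d :=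
  (invWeight k : ℂ) • (shiftHarm d k * diagOp (mulOp (Fin d → ℤ) (y k)))

theorem convTerm_apply (y z : Harm d) (k m : ℤ) (n : Fin d → ℤ) :
    convTerm y k z m n = invWeightOp d y k n * z (m - k) n :=
  calc convTerm y k z m n = (invWeight k : ℂ) * mulOp (Fin d → ℤ) (y k) (z (m - k)) n := rfl
    _ = (invWeight k : ℂ) * y k n * z (m - k) n := by rw [mulOp_apply, mul_assoc]
    _ = invWeightOp d y k n * z (m - k) n := by rw [invWeightOp_apply]; rfl

theorem norm_convTerm_le (y : Harm d) (k : ℤ) : ‖convTerm y k‖ ≤ invWeight k * ‖y k‖ := by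
  rw [convTerm, norm_smul, norm_invWeight]
  refine mul_le_mul_of_nonneg_left ((norm_mul_le _ _).trans ?_) (invWeight_pos k).le
  exact (mul_le_of_le_one_left (norm_nonneg _) (norm_reindexOp_le _)).trans
    ((norm_diagOp_le _).trans (norm_mulOp_le _))

theorem summable_convTerm (y : Harm d) : Summable (convTerm y) :=
  Summable.of_norm_bounded (summable_invWeight_mul_norm y) (norm_convTerm_le y)

/-- Multiplication, on the level of Fourier coefficients, by the function whose harmonics are
`y_m / (1 + m²)`. Only the first factor is weighted, so that the powers of `conv d y` multiply by
the powers of that function. -/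
def conv (d : ℕ) : Harm d →L[ℂ] Harm d →L[ℂ] Harm d :=
  LinearMap.mkContinuous
    { toFun := fun y => ∑' k, convTerm y k
      map_add' := fun y z => by
        rw [← (summable_convTerm y).tsum_add (summable_convTerm z)]
        refine tsum_congr fun k => ?_
        ext x m n
        simp only [add_apply, lp.coeFn_add, Pi.add_apply, convTerm_apply, map_add]
        ring
      map_smul' := fun c y => by
        rw [RingHom.id_apply, ← tsum_const_smul'']
        refine tsum_congr fun k => ?_
        ext x m n
        simp only [smul_apply, lp.coeFn_smul, Pi.smul_apply, convTerm_apply, map_smul,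
          smul_eq_mul]
        ring }
    (∑' k, invWeight k) fun y =>
      (tsum_of_norm_bounded (summable_invWeight_mul_norm y).hasSum (norm_convTerm_le y)).trans
        (tsum_invWeight_mul_norm_le y)

theorem norm_conv_le (y : Harm d) : ‖conv d y‖ ≤ ∑' k, invWeight k * ‖y k‖ :=
  tsum_of_norm_bounded (summable_invWeight_mul_norm y).hasSum (norm_convTerm_le y)

/-- The value of the `m`-th harmonic at `n` as a bounded functional. -/
def evalAt (d : ℕ) (m : ℤ) (n : Fin d → ℤ) : Harm d →L[ℂ] ℂ :=
  (lp.evalCLM ℂ (fun _ : Fin d → ℤ => ℂ) 2 n).comp (lp.evalCLM ℂ (fun _ : ℤ => L2Z d) 2 m)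

theorem evalAt_apply (m : ℤ) (n : Fin d → ℤ) (y : Harm d) : evalAt d m n y = y m n := rfl

theorem hasSum_conv_apply (y z : Harm d) (m : ℤ) (n : Fin d → ℤ) :
    HasSum (fun k => invWeightOp d y k n * z (m - k) n) (conv d y z m n) := by
  have hsum := (evalAt d m n).hasSum
    ((ContinuousLinearMap.apply ℂ (Harm d) z).hasSum (summable_convTerm y).hasSum)
  simp only [ContinuousLinearMap.apply_apply, evalAt_apply, convTerm_apply] at hsum
  exact hsum

theorem conv_apply (y z : Harm d) (m : ℤ) (n : Fin d → ℤ) :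
    conv d y z m n = ∑' k, invWeightOp d y k n * z (m - k) n :=
  (hasSum_conv_apply y z m n).tsum_eq.symm

theorem profile_eq_fourierSum (B : X2 d) (n : Fin d → ℤ) (τ : ℝ) :
    profile B n τ = fourierSum (fun m => invWeightOp d (weightEquiv d B) m n) τ := by
  simp only [profile, fourierSum, harm_eq_invWeightOp]

theorem fourierSum_conv (y z : Harm d) (n : Fin d → ℤ) (hz : Summable fun m => ‖z m n‖) :
    (Summable fun m => ‖conv d y z m n‖) ∧
      ∀ τ, fourierSum (fun m => conv d y z m n) τ
        = fourierSum (fun m => invWeightOp d y m n) τ * fourierSum (fun m => z m n) τ := by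
  simp only [conv_apply]
  exact ⟨summable_norm_convolution (c := fun m => z m n) (summable_norm_invWeightOp_apply y n) hz,
    fourierSum_convolution (c := fun m => z m n) (summable_norm_invWeightOp_apply y n) hz⟩

theorem fourierSum_conv_pow (y z : Harm d) (n : Fin d → ℤ) (k : ℕ)
    (hz : Summable fun m => ‖z m n‖) :
    (Summable fun m => ‖(conv d y ^ k) z m n‖) ∧
      ∀ τ, fourierSum (fun m => (conv d y ^ k) z m n) τ
        = fourierSum (fun m => invWeightOp d y m n) τ ^ k * fourierSum (fun m => z m n) τ := by
  induction k with
  | zero => simpa only [pow_zero, one_mul] using ⟨hz, fun _ => rfl⟩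
  | succ k ih =>
    rw [pow_succ', mul_apply_eq_comp]
    obtain ⟨hsum, hmul⟩ := fourierSum_conv y ((conv d y ^ k) z) n ih.1
    exact ⟨hsum, fun τ => by rw [hmul, ih.2, pow_succ', mul_assoc]⟩

theorem integral_profile_pow_mul (A B : X2 d) (k : ℕ) (m : ℤ) (n : Fin d → ℤ) :
    ∫ τ in (-Real.pi)..Real.pi,
        profile A n τ ^ k * profile B n τ * Complex.exp (-(Complex.I * m * τ))
      = 2 * (Real.pi : ℂ)
        * (conv d (weightEquiv d A) ^ k) (invWeightOp d (weightEquiv d B)) m n := by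
  obtain ⟨hsum, hmul⟩ := fourierSum_conv_pow (weightEquiv d A) _ n k
    (summable_norm_invWeightOp_apply (weightEquiv d B) n)
  rw [← integral_fourierSum_mul_exp hsum]
  simp only [profile_eq_fourierSum, hmul]

end Convolution

section Laplacian

variable {d : ℕ}

theorem norm_shiftOp_le (k : Fin d → ℤ) : ‖(shiftOp k : L2Z d →L[ℂ] L2Z d)‖ ≤ 1 :=
  LinearMap.mkContinuous_norm_le _ zero_le_one _

theorem star_shiftOp (k : Fin d → ℤ) : star (shiftOp k : L2Z d →L[ℂ] L2Z d) = shiftOp (-k) := by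
  rw [ContinuousLinearMap.star_eq_adjoint]
  refine (ContinuousLinearMap.eq_adjoint_iff _ _).mpr (fun f g => ?_) |>.symm
  rw [lp.inner_eq_tsum, lp.inner_eq_tsum, ← (Equiv.addRight k).tsum_eq]
  refine tsum_congr fun n => ?_
  change inner ℂ (f (n + k + -k)) (g (n + k)) = inner ℂ (f n) (g (n + k))
  rw [add_neg_cancel_right]

theorem isSelfAdjoint_lapOp (d : ℕ) : IsSelfAdjoint (lapOp d) := by
  unfold IsSelfAdjoint lapOp
  rw [star_sum]
  refine Finset.sum_congr rfl fun j _ => ?_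
  rw [star_sub, star_add, star_shiftOp, star_shiftOp, neg_neg, star_smul,
    ← ContinuousLinearMap.one_def, star_one, Complex.star_def, map_ofNat,
    add_comm (shiftOp (-Pi.single j 1))]

theorem norm_algebraMap_add_lapOp_le (d : ℕ) :
    ‖algebraMap ℂ (L2Z d →L[ℂ] L2Z d) (2 * d) + lapOp d‖ ≤ 2 * d := by
  have lapOp_eq : algebraMap ℂ (L2Z d →L[ℂ] L2Z d) (2 * d) + lapOp d
      = ∑ j : Fin d, (shiftOp (Pi.single j 1) + shiftOp (-Pi.single j 1)) := by
    rw [lapOp, Finset.sum_sub_distrib, ← ContinuousLinearMap.one_def, Finset.sum_const,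
      Finset.card_univ, Fintype.card_fin, ← Nat.cast_smul_eq_nsmul ℂ, smul_smul,
      mul_comm (d : ℂ), Algebra.algebraMap_eq_smul_one, add_sub_cancel]
  calc ‖algebraMap ℂ (L2Z d →L[ℂ] L2Z d) (2 * d) + lapOp d‖
      ≤ ∑ j : Fin d, ‖(shiftOp (Pi.single j 1) + shiftOp (-Pi.single j 1) :
          L2Z d →L[ℂ] L2Z d)‖ := lapOp_eq ▸ norm_sum_le _ _
    _ ≤ ∑ _j : Fin d, (1 + 1 : ℝ) := Finset.sum_le_sum fun j _ =>
        norm_add_le_of_le (norm_shiftOp_le _) (norm_shiftOp_le _)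
    _ = 2 * d := by simp only [Finset.sum_const, Finset.card_univ, Fintype.card_fin,
        nsmul_eq_mul]; ring

theorem spectrum_lapOp_subset (d : ℕ) :
    spectrum ℂ (lapOp d) ⊆ Complex.ofReal '' Set.Icc (-(4 * d)) 0 := by
  intro z hz
  have hre : z = z.re := (isSelfAdjoint_lapOp d).mem_spectrum_eq_re hz
  have hz' : z + 2 * d ∈ spectrum ℂ (algebraMap ℂ (L2Z d →L[ℂ] L2Z d) (2 * d) + lapOp d) :=
    spectrum.add_mem_add_iff.mpr hz
  have hnorm : ‖z + 2 * d‖ ≤ 2 * d :=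
    (spectrum.norm_le_norm_mul_of_mem hz').trans
      ((mul_le_of_le_one_right (norm_nonneg _) ContinuousLinearMap.norm_id_le).trans
        (norm_algebraMap_add_lapOp_le d))
  have habs : |z.re + 2 * d| ≤ 2 * d := by
    rw [← Real.norm_eq_abs, ← Complex.norm_real]
    push_cast
    rwa [← hre]
  rw [abs_le] at habs
  exact ⟨z.re, ⟨by linarith, by linarith⟩, hre.symm⟩

theorem isUnit_algebraMap_sub_lapOp {z : ℂ} (hz : z ∉ Complex.ofReal '' Set.Icc (-(4 * d)) 0) :
    IsUnit (algebraMap ℂ (L2Z d →L[ℂ] L2Z d) z - lapOp d) :=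
  spectrum.notMem_iff.mp fun h => hz (spectrum_lapOp_subset d h)

end Laplacian

section Linearization

variable {d p : ℕ} {Ω : ℝ} {A : L2Z d}

theorem potOp_eq_mulOp_pow (p : ℕ) (hA : ∀ n, (A n).im = 0) :
    potOp p A = mulOp (Fin d → ℤ) A ^ (2 * p) := by
  ext f n
  rw [potOp_apply, mulOp_pow_apply]
  congr 1
  have hre : A n = ((A n).re : ℂ) := Complex.ext rfl (hA n)
  rw [hre, Complex.norm_real, Real.norm_eq_abs, pow_mul, sq_abs, pow_mul]
  push_cast
  rfl

theorem isCompactOperator_potOp (hp : 1 ≤ p) (hA : ∀ n, (A n).im = 0) :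
    IsCompactOperator (potOp p A) := by
  obtain ⟨k, hk⟩ : ∃ k, 2 * p = k + 1 := ⟨2 * p - 1, by omega⟩
  rw [potOp_eq_mulOp_pow p hA, hk, pow_succ]
  exact (isCompactOperator_mulOp A).clm_comp _

theorem Lplus_eq : Lplus p Ω A = (algebraMap ℂ (L2Z d →L[ℂ] L2Z d) Ω - lapOp d)
    + ((1 + 2 * p) * gam p : ℂ) • potOp p A := by
  rw [Lplus, ← ContinuousLinearMap.one_def, ← Algebra.algebraMap_eq_smul_one]
  abel

theorem Lminus_eq : Lminus p Ω A = (algebraMap ℂ (L2Z d →L[ℂ] L2Z d) Ω - lapOp d)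
    + (gam p : ℂ) • potOp p A := by
  rw [Lminus, ← ContinuousLinearMap.one_def, ← Algebra.algebraMap_eq_smul_one]
  abel

theorem isUnit_Lplus (hp : 1 ≤ p) (hΩ : Ω ∉ Set.Icc (-(4 * (d : ℝ))) 0)
    (hA : ∀ n, (A n).im = 0) (hker : ∀ f : L2Z d, Lplus p Ω A f = 0 → f = 0) :
    IsUnit (Lplus p Ω A) := by
  have hS : IsUnit (algebraMap ℂ (L2Z d →L[ℂ] L2Z d) Ω - lapOp d) :=
    isUnit_algebraMap_sub_lapOp fun ⟨x, hx, h⟩ => hΩ (Complex.ofReal_injective h ▸ hx)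
  rw [Lplus_eq] at hker ⊢
  exact isUnit_add_of_isCompactOperator hS
    ((isCompactOperator_potOp hp hA).smul ((1 + 2 * p) * gam p : ℂ)) hker

/-- The rotation `(x, y) ↦ (-y, x)`, which is the symplectic operator `𝒥` of the dNLS equation. -/
def symplecticOp (E : Type*) [NormedAddCommGroup E] [NormedSpace ℂ E] : E × E →L[ℂ] E × E :=
  (-ContinuousLinearMap.snd ℂ E E).prod (ContinuousLinearMap.fst ℂ E E)

theorem JH_eq_symplecticOp_mul :
    JH p Ω A = symplecticOp (L2Z d) * (Lplus p Ω A).prodMap (Lminus p Ω A) := rfl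

theorem isUnit_prodMap {E F : Type*} [NormedAddCommGroup E] [NormedSpace ℂ E] [CompleteSpace E]
    [NormedAddCommGroup F] [NormedSpace ℂ F] [CompleteSpace F] {S : E →L[ℂ] E} {T : F →L[ℂ] F}
    (hS : IsUnit S) (hT : IsUnit T) : IsUnit (S.prodMap T) := by
  rw [ContinuousLinearMap.isUnit_iff_bijective] at hS hT ⊢
  change Function.Bijective (Prod.map S T)
  exact hS.prodMap hT

theorem isCompactOperator_prodMap {E F : Type*} [NormedAddCommGroup E] [NormedSpace ℂ E]
    [NormedAddCommGroup F] [NormedSpace ℂ F] {S : E →L[ℂ] E} {T : F →L[ℂ] F}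
    (hS : IsCompactOperator S) (hT : IsCompactOperator T) : IsCompactOperator (S.prodMap T) := by
  have decomp : S.prodMap T
      = (ContinuousLinearMap.inl ℂ E F).comp (S.comp (ContinuousLinearMap.fst ℂ E F))
        + (ContinuousLinearMap.inr ℂ E F).comp (T.comp (ContinuousLinearMap.snd ℂ E F)) := by
    ext x <;> simp
  rw [decomp]
  exact ((hS.comp_clm (ContinuousLinearMap.fst ℂ E F)).clm_comp (ContinuousLinearMap.inl ℂ E F)).add
    ((hT.comp_clm (ContinuousLinearMap.snd ℂ E F)).clm_comp (ContinuousLinearMap.inr ℂ E F))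

theorem isUnit_symplecticOp_mul_prodMap_sub {z : ℂ} (hz : z ∉ contSpectrum d Ω) :
    IsUnit (symplecticOp (L2Z d) * ContinuousLinearMap.prodMap
        (algebraMap ℂ (L2Z d →L[ℂ] L2Z d) Ω - lapOp d)
        (algebraMap ℂ (L2Z d →L[ℂ] L2Z d) Ω - lapOp d)
      - algebraMap ℂ _ z) := by
  set S := algebraMap ℂ (L2Z d →L[ℂ] L2Z d) Ω - lapOp d with hS
  have hp : IsUnit (S + algebraMap ℂ _ (Complex.I * z)) := by
    rw [hS, sub_add_eq_add_sub, ← map_add]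
    refine isUnit_algebraMap_sub_lapOp ?_
    rintro ⟨x, hx, h⟩
    refine hz ⟨Ω - x, ⟨by linarith [hx.2], by linarith [hx.1]⟩, Or.inl ?_⟩
    push_cast
    linear_combination Complex.I * h + z * Complex.I_mul_I
  have hm : IsUnit (S - algebraMap ℂ _ (Complex.I * z)) := by
    rw [hS, sub_right_comm, ← map_sub]
    refine isUnit_algebraMap_sub_lapOp ?_
    rintro ⟨x, hx, h⟩
    refine hz ⟨Ω - x, ⟨by linarith [hx.2], by linarith [hx.1]⟩, Or.inr ?_⟩
    push_cast
    linear_combination -Complex.I * h + z * Complex.I_mul_I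
  refine isUnit_mul_sub_algebraMap ?_ ?_ ?_ ?_
  · ext x <;> simp [symplecticOp]
  · rw [commute_iff_eq]
    ext <;> simp [symplecticOp]
  · exact isUnit_prodMap hp hp
  · exact isUnit_prodMap hm hm

theorem exists_bijective_borderedOp_JH (hp : 1 ≤ p) (hA : ∀ n, (A n).im = 0) {Lam : ℂ}
    {f : L2Z d × L2Z d} (heig : IsSimpleIsolatedEigenpair p Ω A Lam f)
    (hcont : 2 * Lam ∉ contSpectrum d Ω) {c : ℂ} (hc : c ≠ 0) :
    ∃ φ : L2Z d × L2Z d →L[ℂ] ℂ, φ f = 1 ∧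
      Function.Bijective (borderedOp (JH p Ω A - (2 * Lam) • 1) (c • f) φ) := by
  obtain ⟨φ, hφ⟩ := SeparatingDual.exists_eq_one (R := ℂ) heig.ne_zero
  have hpot (a : ℂ) : IsCompactOperator (a • potOp p A) := (isCompactOperator_potOp hp hA).smul a
  have decomp : JH p Ω A - (2 * Lam) • 1
      = (symplecticOp (L2Z d) * ContinuousLinearMap.prodMap
          (algebraMap ℂ (L2Z d →L[ℂ] L2Z d) Ω - lapOp d)
          (algebraMap ℂ (L2Z d →L[ℂ] L2Z d) Ω - lapOp d) - algebraMap ℂ _ (2 * Lam))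
        + symplecticOp (L2Z d) * (((1 + 2 * p) * gam p : ℂ) • potOp p A).prodMap
          ((gam p : ℂ) • potOp p A) := by
    have prodMap_add (S T S' T' : L2Z d →L[ℂ] L2Z d) :
        (S + S').prodMap (T + T') = S.prodMap T + S'.prodMap T' := rfl
    rw [sub_add_eq_add_sub, ← mul_add, ← prodMap_add, ← Lplus_eq, ← Lminus_eq,
      ← JH_eq_symplecticOp_mul, Algebra.algebraMap_eq_smul_one]
  exact ⟨φ, hφ, bijective_borderedOp_of_simple_eigenvalue decomp
    (isUnit_symplecticOp_mul_prodMap_sub hcont)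
    ((isCompactOperator_prodMap (hpot _) (hpot _)).clm_comp (symplecticOp (L2Z d)))
    ⟨Module.End.mem_eigenspace_iff.mpr heig.eigen, heig.ne_zero⟩ heig.simple hφ hc⟩

end Linearization

section RescaledOperator

variable {d p : ℕ}

theorem norm_int_mul_invWeight_le (m : ℤ) : ‖(m : ℂ) * (invWeight m : ℂ)‖ ≤ 1 := by
  rw [norm_mul, norm_invWeight, Complex.norm_intCast, invWeight, ← div_eq_mul_inv,
    div_le_one (by positivity)]
  nlinarith [sq_nonneg (|(m : ℝ)| - 1), sq_abs (m : ℝ)]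

theorem norm_int_sq_mul_invWeight_le (m : ℤ) : ‖(m : ℂ) ^ 2 * (invWeight m : ℂ)‖ ≤ 1 := by
  rw [norm_mul, norm_invWeight, norm_pow, Complex.norm_intCast, invWeight, sq_abs,
    ← div_eq_mul_inv, div_le_one (by positivity)]
  linarith

/-- The Fourier multiplier `m / (1 + m²)`: up to a factor `i`, the first derivative in `τ` after
`invWeightOp`. -/
def derivOp (d : ℕ) : Harm d →L[ℂ] Harm d :=
  multOp (fun m => (m : ℂ) * (invWeight m : ℂ)) zero_le_one norm_int_mul_invWeight_le

/-- The Fourier multiplier `m² / (1 + m²)`: up to sign, the second derivative in `τ` after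
`invWeightOp`. -/
def secondDerivOp (d : ℕ) : Harm d →L[ℂ] Harm d :=
  multOp (fun m => (m : ℂ) ^ 2 * (invWeight m : ℂ)) zero_le_one norm_int_sq_mul_invWeight_le

/-- The projection to the harmonics `m = ±1`, which are the resonant ones: their symbol `1 - m²`
in the limit `ε = 0` vanishes. -/
def resonantProj (d : ℕ) : Harm d →L[ℂ] Harm d :=
  multOp (fun m => if m = 1 ∨ m = -1 then 1 else 0) zero_le_one
    (fun m => by split_ifs <;> simp)

theorem derivOp_apply (y : Harm d) (m : ℤ) :
    derivOp d y m = ((m : ℂ) * (invWeight m : ℂ)) • y m := multOp_apply _ _ _ _ _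

theorem secondDerivOp_apply (y : Harm d) (m : ℤ) :
    secondDerivOp d y m = ((m : ℂ) ^ 2 * (invWeight m : ℂ)) • y m := multOp_apply _ _ _ _ _

theorem resonantProj_apply (y : Harm d) (m : ℤ) :
    resonantProj d y m = if m = 1 ∨ m = -1 then y m else 0 := by
  rw [resonantProj, multOp_apply, ite_smul, one_smul, zero_smul]

/-- The Floquet operator with eigenvalue `ε η`, frequency `ω` and potential `W`, acting on weighted
harmonics. The rows `m = ±1` are divided by `ε`, with `σ` in the place of `(1 - ω²) / ε`, so that
the operator is polynomial in all of its parameters. -/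
def floq (d : ℕ) (ε ω σ η : ℂ) (W : Harm d →L[ℂ] Harm d) : Harm d →L[ℂ] Harm d :=
  (1 - resonantProj d) * ((1 + (ε * η) ^ 2) • invWeightOp d
      + (2 * Complex.I * (ε * η) * ω) • derivOp d - ω ^ 2 • secondDerivOp d)
    + resonantProj d * ((σ + ε * η ^ 2) • invWeightOp d + (2 * Complex.I * η * ω) • derivOp d)
    + (resonantProj d + ε • (1 - resonantProj d)) * ((W - diagOp (lapOp d)) * invWeightOp d)

theorem floq_apply (ε ω σ η : ℂ) (W : Harm d →L[ℂ] Harm d) (y : Harm d) (m : ℤ) :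
    floq d ε ω σ η W y m = if m = 1 ∨ m = -1
      then (σ + ε * η ^ 2 + 2 * Complex.I * η * ω * m) • invWeightOp d y m
        + W (invWeightOp d y) m - lapOp d (invWeightOp d y m)
      else (1 + (ε * η + Complex.I * m * ω) ^ 2) • invWeightOp d y m
        + ε • (W (invWeightOp d y) m - lapOp d (invWeightOp d y m)) := by
  simp only [floq, add_apply, sub_apply, smul_apply, mul_apply_eq_comp, one_apply_eq_self,
    lp.coeFn_add, lp.coeFn_sub, lp.coeFn_smul, Pi.add_apply, Pi.sub_apply, Pi.smul_apply,
    resonantProj_apply, diagOp_apply, derivOp_apply, secondDerivOp_apply, invWeightOp_apply]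
  split_ifs
  · module
  · linear_combination (norm := module) (-(m * ω) ^ 2 * invWeight m * Complex.I_mul_I) • y m

theorem contDiff_floq : ContDiff ℂ ⊤
    fun x : (ℂ × ℂ × ℂ × (Harm d →L[ℂ] Harm d)) × ℂ =>
      floq d x.1.1 x.1.2.1 x.1.2.2.1 x.2 x.1.2.2.2 := by
  unfold floq
  fun_prop

theorem floq_eq_zero_iff {ε ω σ η : ℂ} (hε : ε ≠ 0) (hσ : ε * σ = 1 - ω ^ 2)
    (W : Harm d →L[ℂ] Harm d) (y : Harm d) :
    floq d ε ω σ η W y = 0 ↔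
      ∀ m n, (1 + (ε * η + Complex.I * m * ω) ^ 2) * invWeightOp d y m n
        + ε * W (invWeightOp d y) m n = ε * lap (invWeightOp d y m) n := by
  have rescale : ∀ m n, (1 + (ε * η + Complex.I * m * ω) ^ 2) * invWeightOp d y m n
      + ε * W (invWeightOp d y) m n - ε * lap (invWeightOp d y m) n
      = (if m = 1 ∨ m = -1 then ε else 1) * floq d ε ω σ η W y m n := by
    intro m n
    rw [floq_apply, ← lapOp_apply]
    split_ifs with hm
    · simp only [lp.coeFn_sub, lp.coeFn_add, lp.coeFn_smul, Pi.sub_apply, Pi.add_apply,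
        Pi.smul_apply, smul_eq_mul]
      have hm_sq : (m : ℂ) ^ 2 = 1 := by rcases hm with rfl | rfl <;> simp
      linear_combination
        (m ^ 2 * ω ^ 2 * Complex.I_mul_I - ω ^ 2 * hm_sq - hσ) * invWeightOp d y m n
    · simp only [lp.coeFn_sub, lp.coeFn_add, lp.coeFn_smul, Pi.sub_apply, Pi.add_apply,
        Pi.smul_apply, smul_eq_mul]
      ring
  refine ⟨fun h m n => sub_eq_zero.mp ?_, fun h => harm_ext fun m n => ?_⟩
  · rw [rescale, h]
    exact mul_zero _
  · refine (mul_eq_zero.mp ((rescale m n).symm.trans (sub_eq_zero.mpr (h m n)))).resolve_left ?_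
    split_ifs
    exacts [hε, one_ne_zero]

theorem floq_conv_pow_eq_zero_iff {ε ω σ η : ℂ} (hε : ε ≠ 0) (hσ : ε * σ = 1 - ω ^ 2)
    (c : ℂ) (k : ℕ) (A B : X2 d) :
    floq d ε ω σ η (c • conv d (weightEquiv d A) ^ k) (weightEquiv d B) = 0 ↔
      ∀ m n, (1 + (ε * η + Complex.I * m * ω) ^ 2) * B.harm m n
        + ε * c / (2 * Real.pi) * (∫ τ in (-Real.pi)..Real.pi,
          profile A n τ ^ k * profile B n τ * Complex.exp (-(Complex.I * m * τ)))
        = ε * lap (B.harm m) n := by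
  have hpi : (Real.pi : ℂ) ≠ 0 := by exact_mod_cast Real.pi_ne_zero
  rw [floq_eq_zero_iff hε hσ]
  refine forall₂_congr fun m n => ?_
  have hsmul : (c • conv d (weightEquiv d A) ^ k) (invWeightOp d (weightEquiv d B)) m n
      = c * (conv d (weightEquiv d A) ^ k) (invWeightOp d (weightEquiv d B)) m n := rfl
  rw [integral_profile_pow_mul, harm_eq_invWeightOp, hsmul]
  field_simp

theorem isFloquetEigenpair_iff {ε ω : ℝ} {σ η : ℂ} (hε : ε ≠ 0)
    (hσ : (ε : ℂ) * σ = 1 - (ω : ℂ) ^ 2) (A B : X2 d) :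
    IsFloquetEigenpair p ε ω A (ε * η) B ↔ weightEquiv d B ≠ 0 ∧
      floq d ε ω σ η ((1 + 2 * p : ℂ) • conv d (weightEquiv d A) ^ (2 * p)) (weightEquiv d B)
        = 0 := by
  rw [floq_conv_pow_eq_zero_iff (Complex.ofReal_ne_zero.mpr hε) hσ, ne_eq,
    LinearIsometryEquiv.map_eq_zero_iff]
  exact ⟨fun h => ⟨h.ne_zero, h.eq⟩, fun h => ⟨h.1, h.2⟩⟩

theorem breather_eq_iff {ε ω : ℝ} {σ : ℂ} (hε : ε ≠ 0) (hσ : (ε : ℂ) * σ = 1 - (ω : ℂ) ^ 2)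
    (A : X2 d) :
    (∀ (m : ℤ) (n : Fin d → ℤ),
      (1 - (m : ℂ) ^ 2 * (ω : ℂ) ^ 2) * A.harm m n
        + (ε : ℂ) / (2 * Real.pi) * (∫ τ in (-Real.pi)..Real.pi,
            profile A n τ ^ (1 + 2 * p) * Complex.exp (-(Complex.I * m * τ)))
        = (ε : ℂ) * lap (A.harm m) n) ↔
      floq d ε ω σ 0 (conv d (weightEquiv d A) ^ (2 * p)) (weightEquiv d A) = 0 := by
  have h := floq_conv_pow_eq_zero_iff (η := 0) (Complex.ofReal_ne_zero.mpr hε) hσ 1 (2 * p) A A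
  rw [one_smul] at h
  rw [h]
  refine forall₂_congr fun m n => ?_
  have symbol : 1 + ((ε : ℂ) * 0 + Complex.I * m * ω) ^ 2 = 1 - (m : ℂ) ^ 2 * (ω : ℂ) ^ 2 := by
    linear_combination (m * ω) ^ 2 * Complex.I_mul_I
  simp only [symbol, mul_one, ← pow_succ, add_comm 1 (2 * p)]

end RescaledOperator

section SolitonPotential

variable {d p : ℕ}

/-- The sequence of harmonics with entries `u` at `m = 1` and `v` at `m = -1`. -/
def pairEmb (d : ℕ) : L2Z d × L2Z d →L[ℂ] Harm d :=
  (lp.singleContinuousLinearMap ℂ (fun _ : ℤ => L2Z d) 2 1).coprod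
    (lp.singleContinuousLinearMap ℂ (fun _ : ℤ => L2Z d) 2 (-1))

theorem pairEmb_apply (b : L2Z d × L2Z d) (m : ℤ) :
    pairEmb d b m = if m = 1 then b.1 else if m = -1 then b.2 else 0 := by
  have h : pairEmb d b m = (Pi.single 1 b.1 : ℤ → L2Z d) m + (Pi.single (-1) b.2 : ℤ → L2Z d) m :=
    rfl
  rw [h, Pi.single_apply, Pi.single_apply]
  split_ifs <;> simp_all

@[simp] theorem pairEmb_one (b : L2Z d × L2Z d) : pairEmb d b 1 = b.1 := by simp [pairEmb_apply]

@[simp] theorem pairEmb_neg_one (b : L2Z d × L2Z d) : pairEmb d b (-1) = b.2 := by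
  simp [pairEmb_apply]

theorem pairEmb_of_not (b : L2Z d × L2Z d) {m : ℤ} (hm : ¬(m = 1 ∨ m = -1)) :
    pairEmb d b m = 0 := by
  rw [not_or] at hm
  rw [pairEmb_apply, if_neg hm.1, if_neg hm.2]

theorem pairEmb_neg (b : L2Z d × L2Z d) (m : ℤ) : pairEmb d b (-m) = pairEmb d b.swap m := by
  simp only [pairEmb_apply, neg_eq_iff_eq_neg, Prod.fst_swap, Prod.snd_swap, neg_neg]
  split_ifs <;> first | rfl | omega

theorem pairEmb_eq_of_support {y : Harm d} (hy : ∀ m, ¬(m = 1 ∨ m = -1) → y m = 0) :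
    pairEmb d (y 1, y (-1)) = y := by
  refine lp.ext (funext fun m => ?_)
  by_cases hm : m = 1 ∨ m = -1
  · rcases hm with rfl | rfl <;> simp
  · rw [hy m hm, pairEmb_of_not _ hm]

theorem invWeight_one : invWeight 1 = 2⁻¹ := by norm_num [invWeight]

theorem invWeightOp_pairEmb (b : L2Z d × L2Z d) :
    invWeightOp d (pairEmb d ((2 : ℂ) • b)) = pairEmb d b := by
  refine lp.ext (funext fun m => ?_)
  rw [invWeightOp_apply]
  by_cases hm : m = 1 ∨ m = -1
  · rcases hm with rfl | rfl <;>
      simp [smul_smul, invWeight_neg, invWeight_one]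
  · rw [pairEmb_of_not _ hm, pairEmb_of_not _ hm, smul_zero]

/-- The weighted harmonics of `τ ↦ A (e^{iτ} + e^{-iτ})`, the limit of the breathers at `ε = 0`. -/
def solitonHarm (A : L2Z d) : Harm d := pairEmb d ((2 : ℂ) • (A, A))

theorem conv_solitonHarm (A : L2Z d) :
    conv d (solitonHarm A)
      = diagOp (mulOp (Fin d → ℤ) A) * (shiftHarm d 1 + shiftHarm d (-1)) := by
  refine ContinuousLinearMap.ext fun z => harm_ext fun m n => ?_
  have rhs_apply : (diagOp (mulOp (Fin d → ℤ) A) * (shiftHarm d 1 + shiftHarm d (-1)) :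
      Harm d →L[ℂ] Harm d) z m n = A n * (z (m - 1) n + z (m - -1) n) := by
    rw [mul_apply_eq_comp, diagOp_apply, mulOp_apply]
    rfl
  rw [rhs_apply, conv_apply, solitonHarm, invWeightOp_pairEmb, tsum_eq_sum (s := {1, -1})]
  · rw [Finset.sum_pair (by norm_num), pairEmb_one, pairEmb_neg_one]
    ring
  · intro k hk
    rw [pairEmb_of_not _ (by simpa using hk)]
    exact zero_mul _

theorem shiftHarm_mul (k l : ℤ) : shiftHarm d k * shiftHarm d l = shiftHarm d (k + l) := by
  refine ContinuousLinearMap.ext fun y => lp.ext (funext fun m => ?_)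
  rw [mul_apply_eq_comp, shiftHarm_apply, shiftHarm_apply, shiftHarm_apply, sub_sub]

theorem shiftHarm_zero : shiftHarm d 0 = 1 := by
  refine ContinuousLinearMap.ext fun y => lp.ext (funext fun m => ?_)
  rw [shiftHarm_apply, sub_zero, one_apply_eq_self]

theorem shiftHarm_pow (k : ℤ) (j : ℕ) : shiftHarm d k ^ j = shiftHarm d (j * k) := by
  induction j with
  | zero => rw [pow_zero, Nat.cast_zero, zero_mul, shiftHarm_zero]
  | succ j ih => rw [pow_succ, ih, shiftHarm_mul, Nat.cast_succ, add_one_mul]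

theorem shiftHarm_add_pow (k : ℕ) :
    (shiftHarm d 1 + shiftHarm d (-1)) ^ k
      = ∑ j ∈ Finset.range (k + 1), (k.choose j : ℂ) • shiftHarm d (2 * j - k) := by
  have hcomm : Commute (shiftHarm d 1) (shiftHarm d (-1)) := by
    rw [Commute, SemiconjBy, shiftHarm_mul, shiftHarm_mul, add_comm]
  rw [hcomm.add_pow]
  refine Finset.sum_congr rfl fun j hj => ?_
  have hjk : j ≤ k := Nat.lt_succ_iff.mp (Finset.mem_range.mp hj)
  rw [shiftHarm_pow, shiftHarm_pow, shiftHarm_mul, ← nsmul_eq_mul', Nat.cast_smul_eq_nsmul ℂ]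
  congr 2
  push_cast [hjk]
  ring

theorem diagOp_pow (T : L2Z d →L[ℂ] L2Z d) (k : ℕ) :
    (diagOp T : Harm d →L[ℂ] Harm d) ^ k = diagOp (T ^ k) := by
  induction k with
  | zero => rfl
  | succ k ih =>
    rw [pow_succ, ih, pow_succ]
    rfl

theorem commute_diagOp_shiftHarm (T : L2Z d →L[ℂ] L2Z d) (k : ℤ) :
    Commute (diagOp T) (shiftHarm d k) := by
  refine ContinuousLinearMap.ext fun y => lp.ext (funext fun m => ?_)
  rw [mul_apply_eq_comp, mul_apply_eq_comp, diagOp_apply, shiftHarm_apply, shiftHarm_apply,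
    diagOp_apply]

theorem conv_solitonHarm_pow_apply {A : L2Z d} (hA : ∀ n, (A n).im = 0) (p : ℕ) (z : Harm d)
    (m : ℤ) : (conv d (solitonHarm A) ^ (2 * p)) z m
      = potOp p A (∑ j ∈ Finset.range (2 * p + 1),
        ((2 * p).choose j : ℂ) • z (m - (2 * j - (2 * p : ℕ)))) := by
  have hcomm : Commute (diagOp (mulOp (Fin d → ℤ) A)) (shiftHarm d 1 + shiftHarm d (-1)) :=
    (commute_diagOp_shiftHarm _ _).add_right (commute_diagOp_shiftHarm _ _)
  rw [conv_solitonHarm, hcomm.mul_pow, diagOp_pow, shiftHarm_add_pow, ← potOp_eq_mulOp_pow p hA,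
    mul_apply_eq_comp, diagOp_apply, sum_apply, lp.coeFn_sum, Finset.sum_apply]
  rfl

theorem one_add_two_mul_mul_choose (p : ℕ) :
    (1 + 2 * p : ℂ) * ((2 * p).choose p : ℂ) = (1 + p) * gam p := by
  have h : (1 + 2 * p) * (2 * p).choose p = (1 + p) * gam p := by
    rw [gam, add_comm 1 (2 * p), add_comm 1 p, Nat.add_one_mul_choose_eq, mul_comm]
  exact_mod_cast h

theorem gam_eq_choose_add (p : ℕ) :
    (gam p : ℂ) = ((2 * p).choose p : ℂ) + ((2 * p).choose (p + 1) : ℂ) := by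
  have h : gam p = (2 * p).choose p + (2 * p).choose (p + 1) := by
    rw [gam, add_comm 1 (2 * p), add_comm 1 p, Nat.choose_succ_succ']
  exact_mod_cast h

theorem one_add_two_mul_mul_choose_succ (p : ℕ) :
    (1 + 2 * p : ℂ) * ((2 * p).choose (p + 1) : ℂ) = p * gam p := by
  linear_combination (-(1 + 2 * p : ℂ)) * gam_eq_choose_add p - one_add_two_mul_mul_choose p

theorem sum_choose_smul_pairEmb_one (hp : 1 ≤ p) (b : L2Z d × L2Z d) :
    ∑ j ∈ Finset.range (2 * p + 1),
        ((2 * p).choose j : ℂ) • pairEmb d b (1 - (2 * j - (2 * p : ℕ)))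
      = ((2 * p).choose p : ℂ) • b.1 + ((2 * p).choose (p + 1) : ℂ) • b.2 := by
  rw [← Finset.sum_subset (s₁ := {p, p + 1}), Finset.sum_pair (by omega)]
  · have index_p : 1 - (2 * (p : ℤ) - (2 * p : ℕ)) = 1 := by push_cast; ring
    have index_succ : 1 - (2 * ((p + 1 : ℕ) : ℤ) - (2 * p : ℕ)) = -1 := by push_cast; ring
    rw [index_p, index_succ, pairEmb_one, pairEmb_neg_one]
  · intro j hj
    simp only [Finset.mem_insert, Finset.mem_singleton] at hj
    rw [Finset.mem_range]
    omega
  · intro j _ hj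
    simp only [Finset.mem_insert, Finset.mem_singleton] at hj
    rw [pairEmb_of_not _ (by push_cast; omega), smul_zero]

theorem sum_choose_smul_pairEmb_neg (b : L2Z d × L2Z d) (m : ℤ) (k : ℕ) :
    ∑ j ∈ Finset.range (k + 1), (k.choose j : ℂ) • pairEmb d b (-m - (2 * j - k))
      = ∑ j ∈ Finset.range (k + 1), (k.choose j : ℂ) • pairEmb d b.swap (m - (2 * j - k)) := by
  rw [← Finset.sum_range_reflect]
  refine Finset.sum_congr rfl fun j hj => ?_
  have hjk : j ≤ k := Nat.lt_succ_iff.mp (Finset.mem_range.mp hj)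
  have index : -m - (2 * ((k - j : ℕ) : ℤ) - k) = -(m - (2 * j - k)) := by
    push_cast [hjk]
    ring
  rw [Nat.add_sub_cancel, Nat.choose_symm hjk, index, pairEmb_neg]

/-- The potential of the Floquet operator of the soliton, the limit of the potentials of the
breathers at `ε = 0`. -/
def solitonPot (p : ℕ) (A : L2Z d) : Harm d →L[ℂ] Harm d :=
  (1 + 2 * p : ℂ) • conv d (solitonHarm A) ^ (2 * p)

theorem solitonPot_pairEmb_one (hp : 1 ≤ p) {A : L2Z d} (hA : ∀ n, (A n).im = 0)
    (b : L2Z d × L2Z d) : solitonPot p A (pairEmb d b) 1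
      = potOp p A (((1 + p) * gam p : ℂ) • b.1 + (p * gam p : ℂ) • b.2) := by
  rw [solitonPot, smul_apply, lp.coeFn_smul, Pi.smul_apply, conv_solitonHarm_pow_apply hA,
    sum_choose_smul_pairEmb_one hp, ← map_smul, smul_add, smul_smul, smul_smul,
    one_add_two_mul_mul_choose, one_add_two_mul_mul_choose_succ]

theorem solitonPot_pairEmb_neg_one (hp : 1 ≤ p) {A : L2Z d} (hA : ∀ n, (A n).im = 0)
    (b : L2Z d × L2Z d) : solitonPot p A (pairEmb d b) (-1)
      = potOp p A (((1 + p) * gam p : ℂ) • b.2 + (p * gam p : ℂ) • b.1) := by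
  have reflect : solitonPot p A (pairEmb d b) (-1) = solitonPot p A (pairEmb d b.swap) 1 := by
    rw [solitonPot, smul_apply, smul_apply, lp.coeFn_smul, lp.coeFn_smul, Pi.smul_apply,
      Pi.smul_apply, conv_solitonHarm_pow_apply hA, conv_solitonHarm_pow_apply hA,
      sum_choose_smul_pairEmb_neg]
  rw [reflect, solitonPot_pairEmb_one hp hA, Prod.fst_swap, Prod.snd_swap]

end SolitonPotential

section Resonance

variable {d p : ℕ}

/-- The weighted harmonics of the sequence with entries `b₊ ± i b₋` at `m = ±1`. -/
def resEmb (d : ℕ) : L2Z d × L2Z d →L[ℂ] Harm d :=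
  (pairEmb d).comp ((2 : ℂ) •
    (ContinuousLinearMap.fst ℂ (L2Z d) (L2Z d)
      + Complex.I • ContinuousLinearMap.snd ℂ (L2Z d) (L2Z d)).prod
    (ContinuousLinearMap.fst ℂ (L2Z d) (L2Z d)
      - Complex.I • ContinuousLinearMap.snd ℂ (L2Z d) (L2Z d)))

theorem resEmb_apply (b : L2Z d × L2Z d) : resEmb d b
    = pairEmb d ((2 : ℂ) • (b.1 + Complex.I • b.2, b.1 - Complex.I • b.2)) := rfl

theorem resEmb_soliton (A : L2Z d) : resEmb d (A, 0) = solitonHarm A := by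
  rw [resEmb_apply, solitonHarm, smul_zero, add_zero, sub_zero]

/-- The left inverse of `resEmb` that reads the harmonics `m = ±1`. -/
def resProj (d : ℕ) : Harm d →L[ℂ] L2Z d × L2Z d :=
  ((4 : ℂ)⁻¹ • (lp.evalCLM ℂ (fun _ : ℤ => L2Z d) 2 1
      + lp.evalCLM ℂ (fun _ : ℤ => L2Z d) 2 (-1))).prod
    ((-(4 : ℂ)⁻¹ * Complex.I) • (lp.evalCLM ℂ (fun _ : ℤ => L2Z d) 2 1
      - lp.evalCLM ℂ (fun _ : ℤ => L2Z d) 2 (-1)))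

theorem resProj_apply (y : Harm d) : resProj d y
    = ((4 : ℂ)⁻¹ • (y 1 + y (-1)), (-(4 : ℂ)⁻¹ * Complex.I) • (y 1 - y (-1))) := rfl

theorem resProj_resEmb (b : L2Z d × L2Z d) : resProj d (resEmb d b) = b := by
  rw [resProj_apply, resEmb_apply, pairEmb_one, pairEmb_neg_one]
  refine Prod.ext ?_ ?_
  · simp only [Prod.smul_fst, Prod.smul_snd]
    module
  · simp only [Prod.smul_fst, Prod.smul_snd]
    linear_combination (norm := module) (-Complex.I_mul_I) • b.2

theorem resEmb_resProj {y : Harm d} (hy : ∀ m, ¬(m = 1 ∨ m = -1) → y m = 0) :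
    resEmb d (resProj d y) = y := by
  conv_rhs => rw [← pairEmb_eq_of_support hy]
  rw [resProj_apply, resEmb_apply]
  congr 1
  refine Prod.ext ?_ ?_ <;> simp only [Prod.smul_mk]
  · linear_combination (norm := module) (-(1 / 2 : ℂ) * Complex.I_mul_I) • (y 1 - y (-1))
  · linear_combination (norm := module) ((1 / 2 : ℂ) * Complex.I_mul_I) • (y 1 - y (-1))

/-- The sequence of residuals with entries `c₂ ∓ i c₁` at `m = ±1`: the rows `m = ±1` of the Floquet
problem, written as a pair of rows of `𝒥ℋ''`. -/
def rowEmb (d : ℕ) : L2Z d × L2Z d →L[ℂ] Harm d :=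
  (pairEmb d).comp ((ContinuousLinearMap.snd ℂ (L2Z d) (L2Z d)
      - Complex.I • ContinuousLinearMap.fst ℂ (L2Z d) (L2Z d)).prod
    (ContinuousLinearMap.snd ℂ (L2Z d) (L2Z d)
      + Complex.I • ContinuousLinearMap.fst ℂ (L2Z d) (L2Z d)))

theorem rowEmb_apply (c : L2Z d × L2Z d) : rowEmb d c
    = pairEmb d (c.2 - Complex.I • c.1, c.2 + Complex.I • c.1) := rfl

/-- The left inverse of `rowEmb` that reads the rows `m = ±1`. -/
def rowProj (y : Harm d) : L2Z d × L2Z d :=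
  ((Complex.I / 2) • (y 1 - y (-1)), (2 : ℂ)⁻¹ • (y 1 + y (-1)))

theorem rowEmb_injective : Function.Injective (rowEmb d) := by
  refine Function.LeftInverse.injective (g := rowProj) fun c => ?_
  rw [rowEmb_apply, rowProj, pairEmb_one, pairEmb_neg_one]
  refine Prod.ext ?_ ?_
  · linear_combination (norm := module) (-Complex.I_mul_I) • c.1
  · module

theorem rowEmb_rowProj {y : Harm d} (hy : ∀ m, ¬(m = 1 ∨ m = -1) → y m = 0) :
    rowEmb d (rowProj y) = y := by
  conv_rhs => rw [← pairEmb_eq_of_support hy]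
  rw [rowEmb_apply, rowProj]
  congr 2
  · linear_combination (norm := module) (-(1 / 2 : ℂ) * Complex.I_mul_I) • (y 1 - y (-1))
  · linear_combination (norm := module) ((1 / 2 : ℂ) * Complex.I_mul_I) • (y 1 - y (-1))

theorem floq_zero_apply_of_not (σ η : ℂ) (W : Harm d →L[ℂ] Harm d) (y : Harm d) {m : ℤ}
    (hm : ¬(m = 1 ∨ m = -1)) :
    floq d 0 1 σ η W y m = ((1 - (m : ℂ) ^ 2) * invWeight m) • y m := by
  rw [floq_apply, if_neg hm, invWeightOp_apply]
  linear_combination (norm := module) ((m : ℂ) ^ 2 * invWeight m * Complex.I_mul_I) • y m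

theorem floq_zero_resEmb (hp : 1 ≤ p) (Ω : ℝ) {A : L2Z d} (hA : ∀ n, (A n).im = 0) (η : ℂ)
    (b : L2Z d × L2Z d) :
    floq d 0 1 Ω η (solitonPot p A) (resEmb d b) = rowEmb d (JH p Ω A b - (2 * η) • b) := by
  have hI := Complex.I_mul_I
  have hJH : JH p Ω A b = (-Lminus p Ω A b.2, Lplus p Ω A b.1) := rfl
  have hplus : Lplus p Ω A b.1 = (Ω : ℂ) • b.1 + ((1 + 2 * p) * gam p : ℂ) • potOp p A b.1
      - lapOp d b.1 := rfl
  have hminus : Lminus p Ω A b.2 = (Ω : ℂ) • b.2 + (gam p : ℂ) • potOp p A b.2 - lapOp d b.2 := rfl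
  rw [rowEmb_apply, resEmb_apply, hJH, hplus, hminus]
  refine lp.ext (funext fun m => ?_)
  by_cases hm : m = 1 ∨ m = -1
  · rw [floq_apply, if_pos hm, invWeightOp_pairEmb]
    rcases hm with rfl | rfl
    · rw [solitonPot_pairEmb_one hp hA, pairEmb_one, pairEmb_one]
      simp only [map_add, map_sub, map_smul, Prod.fst_sub, Prod.snd_sub, Prod.smul_fst,
        Prod.smul_snd]
      push_cast
      linear_combination (norm := module) (2 * η * hI) • b.2
    · rw [solitonPot_pairEmb_neg_one hp hA, pairEmb_neg_one, pairEmb_neg_one]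
      simp only [map_add, map_sub, map_smul, Prod.fst_sub, Prod.snd_sub, Prod.smul_fst,
        Prod.smul_snd]
      push_cast
      linear_combination (norm := module) (2 * η * hI) • b.2
  · rw [floq_zero_apply_of_not _ _ _ _ hm, pairEmb_of_not _ hm, pairEmb_of_not _ hm, smul_zero]

theorem nonresonant_symbol_ne_zero {m : ℤ} (hm : ¬(m = 1 ∨ m = -1)) :
    (1 - (m : ℂ) ^ 2) * invWeight m ≠ 0 := by
  refine mul_ne_zero (fun h => hm ?_) (Complex.ofReal_ne_zero.mpr (invWeight_pos m).ne')
  have hsq : (m : ℂ) ^ 2 = 1 := (sub_eq_zero.mp h).symm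
  exact sq_eq_one_iff.mp (by exact_mod_cast hsq)

theorem norm_nonresonant_symbol_inv_le (m : ℤ) :
    ‖(if m = 1 ∨ m = -1 then 0 else ((1 - (m : ℂ) ^ 2) * invWeight m)⁻¹)‖ ≤ 2 := by
  split_ifs with hm
  · rw [norm_zero]
    exact zero_le_two
  rw [norm_inv, norm_mul, norm_invWeight, invWeight, mul_inv, inv_inv, ← div_eq_inv_mul]
  have hreal : ‖1 - (m : ℂ) ^ 2‖ = |1 - (m : ℝ) ^ 2| := by
    rw [← Real.norm_eq_abs, ← Complex.norm_real]
    push_cast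
    rfl
  rw [hreal]
  obtain rfl | hm₂ : m = 0 ∨ 2 ≤ |m| := by
    rcases abs_cases m with h | h <;> omega
  · norm_num
  · have hsq : (4 : ℝ) ≤ (m : ℝ) ^ 2 := by
      exact_mod_cast (by nlinarith [sq_abs m] : (4 : ℤ) ≤ m ^ 2)
    rw [abs_of_nonpos (by linarith), div_le_iff₀ (by linarith)]
    linarith

/-- The inverse of the Floquet operator at `ε = 0` on the nonresonant harmonics. -/
def nonresInv (d : ℕ) : Harm d →L[ℂ] Harm d :=
  multOp (fun m => if m = 1 ∨ m = -1 then 0 else ((1 - (m : ℂ) ^ 2) * invWeight m)⁻¹)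
    zero_le_two norm_nonresonant_symbol_inv_le

theorem nonresInv_apply (z : Harm d) (m : ℤ) : nonresInv d z m
    = (if m = 1 ∨ m = -1 then 0 else ((1 - (m : ℂ) ^ 2) * (invWeight m : ℂ))⁻¹) • z m :=
  multOp_apply _ _ _ _ _

theorem sub_floq_zero_nonresInv_apply_of_not (σ η : ℂ) (W : Harm d →L[ℂ] Harm d) (z : Harm d)
    {m : ℤ} (hm : ¬(m = 1 ∨ m = -1)) : (z - floq d 0 1 σ η W (nonresInv d z)) m = 0 := by
  rw [lp.coeFn_sub, Pi.sub_apply, floq_zero_apply_of_not _ _ _ _ hm, nonresInv_apply, if_neg hm,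
    smul_smul, mul_inv_cancel₀ (nonresonant_symbol_ne_zero hm), one_smul, sub_self]

theorem apply_eq_zero_of_floq_zero_eq_rowEmb {σ η : ℂ} {W : Harm d →L[ℂ] Harm d} {y : Harm d}
    {c : L2Z d × L2Z d} (h : floq d 0 1 σ η W y = rowEmb d c) {m : ℤ} (hm : ¬(m = 1 ∨ m = -1)) :
    y m = 0 := by
  have hy : ((1 - (m : ℂ) ^ 2) * invWeight m) • y m = 0 := by
    rw [← floq_zero_apply_of_not σ η W y hm, h, rowEmb_apply, pairEmb_of_not _ hm]
  exact (smul_eq_zero.mp hy).resolve_left (nonresonant_symbol_ne_zero hm)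

theorem bijective_borderedOp_floq_zero (hp : 1 ≤ p) {Ω : ℝ} {A : L2Z d}
    (hA : ∀ n, (A n).im = 0) {η : ℂ} {c : L2Z d × L2Z d} {φ : L2Z d × L2Z d →L[ℂ] ℂ}
    (hbij : Function.Bijective (borderedOp (JH p Ω A - (2 * η) • 1) c φ)) :
    Function.Bijective
      (borderedOp (floq d 0 1 Ω η (solitonPot p A)) (rowEmb d c) (φ.comp (resProj d))) := by
  set L := floq d 0 1 Ω η (solitonPot p A)
  rw [← Set.bijOn_univ]
  refine bijOn_of_comm_square
    (T := (borderedOp L (rowEmb d c) (φ.comp (resProj d)) : Harm d × ℂ →ₗ[ℂ] Harm d × ℂ))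
    (M := (borderedOp (JH p Ω A - (2 * η) • 1) c φ : (L2Z d × L2Z d) × ℂ →ₗ[ℂ] _))
    (r := ((resEmb d).prodMap (.id ℂ ℂ) : (L2Z d × L2Z d) × ℂ →ₗ[ℂ] Harm d × ℂ))
    (s := ((rowEmb d).prodMap (.id ℂ ℂ) : (L2Z d × L2Z d) × ℂ →ₗ[ℂ] Harm d × ℂ))
    (X' := ⊤) (Z' := ⊤) (fun _ _ => trivial) (fun _ => trivial)
    (rowEmb_injective.prodMap Function.injective_id) ?_ hbij ?_ ?_
  · rintro ⟨b, t⟩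
    refine Prod.ext ?_ (congrArg φ (resProj_resEmb b))
    change L (resEmb d b) + t • rowEmb d c = rowEmb d ((JH p Ω A - (2 * η) • 1) b + t • c)
    rw [floq_zero_resEmb hp Ω hA, map_add, map_smul]
    rfl
  · rintro ⟨y, t⟩ - ⟨⟨b, u⟩, hb⟩
    have hL : L y = rowEmb d (b - t • c) := by
      rw [map_sub, map_smul]
      exact eq_sub_of_add_eq (congrArg Prod.fst hb).symm
    exact ⟨(resProj d y, t),
      Prod.ext (resEmb_resProj fun m hm => apply_eq_zero_of_floq_zero_eq_rowEmb hL hm) rfl⟩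
  · rintro ⟨z, t⟩ -
    refine ⟨(nonresInv d z, 0), trivial,
      (rowProj (z - L (nonresInv d z)), t - φ (resProj d (nonresInv d z))), Prod.ext ?_ rfl⟩
    change rowEmb d (rowProj _) = z - (L (nonresInv d z) + (0 : ℂ) • rowEmb d c)
    rw [rowEmb_rowProj fun m hm => sub_floq_zero_nonresInv_apply_of_not _ _ _ _ hm, zero_smul,
      add_zero]

end Resonance

section FloquetSolution

variable {d p : ℕ}

/-- The parameters `(ε, ω, σ, W)` of the rescaled Floquet operator. -/
abbrev Params (d : ℕ) : Type := ℂ × ℂ × ℂ × (Harm d →L[ℂ] Harm d)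

/-- The Floquet operator as a function of its parameters and of the rescaled eigenvalue. -/
def floqAt (θ : Params d) (η : ℂ) : Harm d →L[ℂ] Harm d :=
  floq d θ.1 θ.2.1 θ.2.2.1 η θ.2.2.2

/-- The parameters of the soliton, at `ε = 0`. -/
def solitonParams (p : ℕ) (Ω : ℝ) (A : L2Z d) : Params d := (0, 1, Ω, solitonPot p A)

theorem floqAt_solitonParams_add (Ω : ℝ) (A : L2Z d) (η ν : ℂ) :
    floqAt (solitonParams p Ω A) (η + ν) = floqAt (solitonParams p Ω A) η
      + ν • (2 * Complex.I) • (resonantProj d * derivOp d) := by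
  simp only [floqAt, solitonParams, floq, mul_add, mul_sub, mul_smul_comm]
  module

theorem exists_floquet_solution (hp : 1 ≤ p) {Ω : ℝ} {A : L2Z d} (hA : ∀ n, (A n).im = 0)
    {Lam : ℂ} {f : L2Z d × L2Z d} (heig : IsSimpleIsolatedEigenpair p Ω A Lam f)
    (hcont : 2 * Lam ∉ contSpectrum d Ω) :
    ∃ (ν : Params d → ℂ) (v : Params d → Harm d), AnalyticAt ℂ ν (solitonParams p Ω A) ∧
      AnalyticAt ℂ v (solitonParams p Ω A) ∧ ν (solitonParams p Ω A) = 0 ∧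
      v (solitonParams p Ω A) = resEmb d f ∧
      (∀ᶠ θ in 𝓝 (solitonParams p Ω A), v θ ≠ 0 ∧ floqAt θ (Lam + ν θ) (v θ) = 0) ∧
      ∀ᶠ x in 𝓝 (solitonParams p Ω A, (0 : ℂ)), ∀ D ≠ 0, floqAt x.1 (Lam + x.2) D = 0 →
        x.2 = ν x.1 ∧ ∃ c : ℂ, D = c • v x.1 := by
  obtain ⟨φ, hφ, hbij⟩ :=
    exists_bijective_borderedOp_JH hp hA heig hcont (neg_ne_zero.mpr (two_ne_zero' ℂ))
  set θ₀ := solitonParams p Ω A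
  have floqAt_resEmb : ∀ η, floqAt θ₀ η (resEmb d f) = rowEmb d (JH p Ω A f - (2 * η) • f) :=
    fun η => floq_zero_resEmb hp Ω hA η f
  have kernel : floqAt θ₀ Lam (resEmb d f) = 0 := by
    rw [floqAt_resEmb, heig.eigen, sub_self, map_zero]
  have deriv_eigenvalue : ((2 * Complex.I) • (resonantProj d * derivOp d)) (resEmb d f)
      = rowEmb d ((-2 : ℂ) • f) := by
    have h := congrArg (fun T : Harm d →L[ℂ] Harm d => T (resEmb d f))
      (floqAt_solitonParams_add (p := p) Ω A Lam 1)
    simp only [one_smul, add_apply] at h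
    rw [kernel, zero_add, floqAt_resEmb, heig.eigen] at h
    rw [← h]
    congr 1
    module
  refine exists_kernel_branch (L := fun x : Params d × ℂ => floqAt x.1 (Lam + x.2))
    (φ := φ.comp (resProj d)) ?_ (floqAt_solitonParams_add Ω A Lam) kernel ?_ ?_
  · exact (contDiff_floq.comp (f := fun x : Params d × ℂ => (x.1, Lam + x.2))
      (by fun_prop)).contDiffAt.analyticAt
  · rw [ContinuousLinearMap.comp_apply, resProj_resEmb, hφ]
  · rw [deriv_eigenvalue]
    exact bijective_borderedOp_floq_zero hp hA hbij

end FloquetSolution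

section HarmonicEstimates

variable {d : ℕ}

theorem norm_harm_weightEquiv_symm_sub_le (y y₀ : Harm d) (m : ℤ) :
    ‖((weightEquiv d).symm y).harm m - invWeightOp d y₀ m‖ ≤ invWeight m * ‖y - y₀‖ := by
  rw [harm_weightEquiv_symm, invWeightOp_apply, ← smul_sub, norm_smul, norm_invWeight]
  exact mul_le_mul_of_nonneg_left (lp.norm_apply_le_norm two_ne_zero (y - y₀) m)
    (invWeight_pos m).le

theorem tsum_norm_harm_weightEquiv_symm_le {ι : Type*} {i : ι → ℤ} (hi : Function.Injective i)
    (y : Harm d) {y₀ : Harm d} (h : ∀ j, y₀ (i j) = 0) :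
    ∑' j, ‖((weightEquiv d).symm y).harm (i j)‖ ≤ (∑' k, invWeight k) * ‖y - y₀‖ := by
  have harm_eq : ∀ j, ‖((weightEquiv d).symm y).harm (i j)‖
      = invWeight (i j) * ‖(y - y₀) (i j)‖ := fun j => by
    rw [harm_weightEquiv_symm, norm_smul, norm_invWeight, lp.coeFn_sub, Pi.sub_apply, h, sub_zero]
  simp only [harm_eq]
  exact (tsum_comp_le_tsum_of_inj (summable_invWeight_mul_norm (y - y₀))
    (fun k => mul_nonneg (invWeight_pos k).le (norm_nonneg _)) hi).trans
    (tsum_invWeight_mul_norm_le (y - y₀))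

theorem norm_harm_sub_resEmb_add_le (y : Harm d) (b : L2Z d × L2Z d) :
    ‖((weightEquiv d).symm y).harm 1 - b.1 - Complex.I • b.2‖
      + ‖((weightEquiv d).symm y).harm (-1) - b.1 + Complex.I • b.2‖ ≤ ‖y - resEmb d b‖ := by
  have h₁ := norm_harm_weightEquiv_symm_sub_le y (resEmb d b) 1
  have h₂ := norm_harm_weightEquiv_symm_sub_le y (resEmb d b) (-1)
  rw [invWeight_neg] at h₂
  rw [invWeight_one] at h₁ h₂
  rw [resEmb_apply, invWeightOp_pairEmb, ← resEmb_apply] at h₁ h₂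
  rw [pairEmb_one, ← sub_sub] at h₁
  rw [pairEmb_neg_one, ← sub_add] at h₂
  linarith

theorem tsum_int_of_even {f : ℤ → ℝ} (heven : f.Even) (hf : Summable f) :
    ∑' m, f m = f 0 + 2 * (f 1 + ∑' m : ℕ, f (m + 2)) := by
  have hs : Summable fun m : ℕ => f (m + 1) :=
    hf.comp_injective (i := fun m : ℕ => (m : ℤ) + 1) (fun a b h => by simpa using h)
  rw [tsum_int_eq_zero_add_two_mul_tsum_pnat heven hf,
    tsum_pnat_eq_tsum_succ (f := fun m : ℕ => f m)]
  simp only [Nat.cast_succ]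
  rw [hs.tsum_eq_zero_add]
  simp only [Nat.cast_zero, zero_add, Nat.cast_succ, add_assoc, one_add_one_eq_two,
    nsmul_eq_mul]

theorem norm_conv_sub_conv_solitonHarm_le {B : X2 d} (heven : ∀ m, B.harm (-m) = B.harm m)
    (A : L2Z d) :
    ‖conv d (weightEquiv d B) - conv d (solitonHarm A)‖
      ≤ 2 * (‖B.harm 0‖ + ‖B.harm 1 - A‖ + ∑' m : ℕ, ‖B.harm (m + 2)‖) := by
  have weighted : ∀ m, invWeight m * ‖(weightEquiv d B - solitonHarm A) m‖
      = ‖B.harm m - pairEmb d (A, A) m‖ := fun m => by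
    rw [harm_eq_invWeightOp, ← invWeightOp_pairEmb (A, A), ← solitonHarm, ← norm_invWeight,
      ← norm_smul, ← invWeightOp_apply, map_sub]
    rfl
  have heven' : (fun m => ‖B.harm m - pairEmb d (A, A) m‖).Even := fun m => by
    simp only [heven, pairEmb_neg, Prod.swap_prod_mk]
  have hsum := summable_invWeight_mul_norm (weightEquiv d B - solitonHarm A)
  have hfar : ∀ m : ℕ, pairEmb d (A, A) (m + 2) = 0 := fun m => pairEmb_of_not _ (by omega)
  simp only [weighted] at hsum
  rw [← map_sub]
  refine (norm_conv_le _).trans ?_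
  simp only [weighted]
  rw [tsum_int_of_even heven' hsum]
  simp only [pairEmb_one, pairEmb_of_not (A, A) (m := 0) (by norm_num), hfar, sub_zero]
  linarith [norm_nonneg (B.harm 0)]

end HarmonicEstimates

section BranchParameters

open Asymptotics

variable {d p : ℕ} {Ω ε ε₁ C₁ : ℝ} {A₀ : L2Z d} {ω : ℝ → ℝ} {A : ℝ → X2 d}

/-- The detuning `(1 - ω(ε)²) / ε` of a branch, continued by its limit `Ω` at `ε = 0`. -/
def freqRatio (Ω : ℝ) (ω : ℝ → ℝ) (ε : ℝ) : ℝ := if ε = 0 then Ω else (1 - ω ε ^ 2) / ε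

theorem mul_freqRatio (hε : ε ≠ 0) :
    (ε : ℂ) * (freqRatio Ω ω ε : ℂ) = 1 - (ω ε : ℂ) ^ 2 := by
  have h : ε * freqRatio Ω ω ε = 1 - ω ε ^ 2 := by
    rw [freqRatio, if_neg hε, mul_div_cancel₀ _ hε]
  exact_mod_cast h

theorem isBigO_freq_sub_one
    (h : (fun ε => ω ε - 1 + ε * Ω / 2) =O[𝓝[>] 0] fun ε : ℝ => ε ^ 2) :
    (fun ε => ω ε - 1) =O[𝓝[>] 0] fun ε : ℝ => ε := by
  have hsq : (fun ε : ℝ => ε ^ 2) =O[𝓝[>] 0] fun ε : ℝ => ε :=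
    ((isLittleO_pow_id one_lt_two).isBigO).mono nhdsWithin_le_nhds
  have hlin : (fun ε : ℝ => ε * (Ω / 2)) =O[𝓝[>] 0] fun ε : ℝ => ε := by
    simpa only [mul_comm] using isBigO_const_mul_self (Ω / 2) (fun ε : ℝ => ε) (𝓝[>] 0)
  exact ((h.trans hsq).sub hlin).congr_left fun ε => by ring

theorem isBigO_freqRatio_sub
    (h : (fun ε => ω ε - 1 + ε * Ω / 2) =O[𝓝[>] 0] fun ε : ℝ => ε ^ 2) :
    (fun ε => freqRatio Ω ω ε - Ω) =O[𝓝[>] 0] fun ε : ℝ => ε := by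
  have hquot := ((h.const_mul_left 2).add ((isBigO_freq_sub_one h).pow 2)).mul
    (isBigO_refl (fun ε : ℝ => ε⁻¹) (𝓝[>] 0))
  refine hquot.neg_left.congr' ?_ ?_ <;> filter_upwards [self_mem_nhdsWithin] with ε hε
  · have hε' : ε ≠ 0 := ne_of_gt hε
    rw [freqRatio, if_neg hε']
    field_simp
    ring
  · have hε' : ε ≠ 0 := ne_of_gt hε
    field_simp

/-- The parameters of the rescaled Floquet problem along a branch. -/
def branchParams (p : ℕ) (Ω : ℝ) (ω : ℝ → ℝ) (A : ℝ → X2 d) (ε : ℝ) : Params d :=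
  (ε, ω ε, freqRatio Ω ω ε, (1 + 2 * p : ℂ) • conv d (weightEquiv d (A ε)) ^ (2 * p))

theorem isFloquetEigenpair_iff_floqAt (hε : ε ≠ 0) (η : ℂ) (B : X2 d) :
    IsFloquetEigenpair p ε (ω ε) (A ε) (ε * η) B ↔ weightEquiv d B ≠ 0 ∧
      floqAt (branchParams p Ω ω A ε) η (weightEquiv d B) = 0 :=
  isFloquetEigenpair_iff hε (mul_freqRatio hε) (A ε) B

theorem IsBreatherBranch.isBigO_freq (hε₁ : 0 < ε₁) (h : IsBreatherBranch p Ω A₀ ε₁ C₁ ω A) :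
    (fun ε => ω ε - 1 + ε * Ω / 2) =O[𝓝[>] 0] fun ε : ℝ => ε ^ 2 := by
  refine IsBigO.of_bound C₁ ?_
  filter_upwards [Ioo_mem_nhdsGT hε₁] with ε hε
  simpa only [Real.norm_eq_abs, abs_of_nonneg (sq_nonneg ε)] using h.freq_bound ε hε

theorem IsBreatherBranch.isBigO_conv (hε₁ : 0 < ε₁) (h : IsBreatherBranch p Ω A₀ ε₁ C₁ ω A) :
    (fun ε => conv d (weightEquiv d (A ε)) - conv d (solitonHarm A₀))
      =O[𝓝[>] 0] fun ε : ℝ => ε := by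
  refine IsBigO.of_bound (2 * C₁) ?_
  filter_upwards [Ioo_mem_nhdsGT hε₁] with ε hε
  refine (norm_conv_sub_conv_solitonHarm_le (h.breather ε hε).even A₀).trans ?_
  rw [Real.norm_of_nonneg hε.1.le, mul_assoc]
  exact mul_le_mul_of_nonneg_left (h.harm_bound ε hε) zero_le_two

theorem tendsto_of_isBigO_sub {E : Type*} [NormedAddCommGroup E] {u : ℝ → E} {u₀ : E}
    (h : (fun ε => u ε - u₀) =O[𝓝[>] 0] fun ε : ℝ => ε) :
    Filter.Tendsto u (𝓝[>] 0) (𝓝 u₀) :=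
  tendsto_sub_nhds_zero_iff.mp
    (h.trans_tendsto (tendsto_nhdsWithin_of_tendsto_nhds Filter.tendsto_id))

theorem IsBreatherBranch.isBigO_branchParams (hε₁ : 0 < ε₁)
    (h : IsBreatherBranch p Ω A₀ ε₁ C₁ ω A) :
    (fun ε => branchParams p Ω ω A ε - solitonParams p Ω A₀) =O[𝓝[>] 0] fun ε : ℝ => ε := by
  have ofReal : ∀ {u : ℝ → ℝ} {u₀ : ℝ}, (fun ε => u ε - u₀) =O[𝓝[>] 0] (fun ε : ℝ => ε) →
      (fun ε => (u ε : ℂ) - (u₀ : ℂ)) =O[𝓝[>] 0] fun ε : ℝ => ε := fun hu => by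
    refine IsBigO.of_norm_left ?_
    simpa only [← Complex.ofReal_sub, Complex.norm_real] using hu.norm_left
  have hconv := h.isBigO_conv hε₁
  have hpot : DifferentiableAt ℂ (fun T : Harm d →L[ℂ] Harm d => (1 + 2 * p : ℂ) • T ^ (2 * p))
      (conv d (solitonHarm A₀)) := by fun_prop
  have hid : (fun ε : ℝ => ε - 0) =O[𝓝[>] 0] fun ε : ℝ => ε := by
    simpa only [sub_zero] using isBigO_refl (fun ε : ℝ => ε) (𝓝[>] 0)
  exact (ofReal hid).prod_left ((ofReal (isBigO_freq_sub_one (h.isBigO_freq hε₁))).prod_left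
    ((ofReal (isBigO_freqRatio_sub (h.isBigO_freq hε₁))).prod_left
      ((hpot.isBigO_sub.comp_tendsto (tendsto_of_isBigO_sub hconv)).trans hconv)))

theorem analyticAt_freqRatio (hε : ε ≠ 0) (hω : AnalyticAt ℝ ω ε) :
    AnalyticAt ℝ (freqRatio Ω ω) ε := by
  have hquot : AnalyticAt ℝ (fun x => (1 - ω x ^ 2) / x) ε :=
    (analyticAt_const.sub (hω.pow 2)).div analyticAt_id hε
  refine hquot.congr ?_
  filter_upwards [isOpen_ne.mem_nhds hε] with x hx
  rw [freqRatio, if_neg hx]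

theorem analyticAt_freqRatio_zero (hω : AnalyticAt ℝ ω 0)
    (h : (fun ε => ω ε - 1 + ε * Ω / 2) =O[𝓝[>] 0] fun ε : ℝ => ε ^ 2) :
    AnalyticAt ℝ (freqRatio Ω ω) 0 := by
  have hω₀ : ω 0 = 1 := tendsto_nhds_unique
    (tendsto_nhdsWithin_of_tendsto_nhds hω.continuousAt)
    (tendsto_of_isBigO_sub (isBigO_freq_sub_one h))
  set g : ℝ → ℝ := fun x => 1 - ω x ^ 2
  obtain ⟨_, hq⟩ : AnalyticAt ℝ g 0 := analyticAt_const.sub (hω.pow 2)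
  have hslope : AnalyticAt ℝ (dslope g 0) 0 := ⟨_, hq.has_fpower_series_dslope_fslope⟩
  have hne : ∀ x, x ≠ 0 → dslope g 0 x = freqRatio Ω ω x := fun x hx => by
    rw [dslope_of_ne _ hx, slope_def_field, freqRatio, if_neg hx, sub_zero]
    simp [g, hω₀]
  have hzero : dslope g 0 0 = Ω := by
    refine tendsto_nhds_unique (tendsto_nhdsWithin_of_tendsto_nhds hslope.continuousAt)
      ((tendsto_of_isBigO_sub (isBigO_freqRatio_sub h)).congr' ?_)
    filter_upwards [self_mem_nhdsWithin] with x hx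
    exact (hne x (ne_of_gt hx)).symm
  refine hslope.congr (Filter.Eventually.of_forall fun x => ?_)
  obtain rfl | hx := eq_or_ne x 0
  · rw [hzero, freqRatio, if_pos rfl]
  · exact hne x hx

theorem analyticAt_branchParams (hω : AnalyticAt ℝ ω ε)
    (hσ : AnalyticAt ℝ (freqRatio Ω ω) ε) (hA : AnalyticAt ℝ A ε) :
    AnalyticAt ℝ (branchParams p Ω ω A) ε := by
  have ofReal : ∀ {u : ℝ → ℝ}, AnalyticAt ℝ u ε → AnalyticAt ℝ (fun x => (u x : ℂ)) ε :=
    fun hu => (Complex.ofRealCLM.analyticAt _).comp hu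
  have hw : ContDiff ℂ ⊤ (weightEquiv d) := (weightEquiv d).contDiff
  have hpot :
      ContDiff ℂ ⊤ fun B : X2 d => (1 + 2 * p : ℂ) • conv d (weightEquiv d B) ^ (2 * p) := by
    fun_prop
  exact (ofReal analyticAt_id).prod ((ofReal hω).prod ((ofReal hσ).prod
    ((hpot.contDiffAt (x := A ε)).analyticAt.restrictScalars.comp hA)))

end BranchParameters

section FloquetBranch

variable {d p : ℕ} {Ω ε₁ C₁ : ℝ} {A₀ : L2Z d} {ω : ℝ → ℝ} {A : ℝ → X2 d}

theorem IsBreatherBranch.analyticAt_branchParams_zero (hε₁ : 0 < ε₁)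
    (h : IsBreatherBranch p Ω A₀ ε₁ C₁ ω A) (hω : AnalyticAt ℝ ω 0) (hA : AnalyticAt ℝ A 0) :
    AnalyticAt ℝ (branchParams p Ω ω A) 0 ∧ branchParams p Ω ω A 0 = solitonParams p Ω A₀ := by
  have hθ : AnalyticAt ℝ (branchParams p Ω ω A) 0 :=
    analyticAt_branchParams hω (analyticAt_freqRatio_zero hω (h.isBigO_freq hε₁)) hA
  exact ⟨hθ, tendsto_nhds_unique (tendsto_nhdsWithin_of_tendsto_nhds hθ.continuousAt)
    (tendsto_of_isBigO_sub (h.isBigO_branchParams hε₁))⟩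

theorem exists_forall_norm_le_of_eventually_nhds {X E : Type*} [TopologicalSpace X]
    [SeminormedAddCommGroup E] {x₀ : X} {P : X × E → Prop} (h : ∀ᶠ v in 𝓝 (x₀, 0), P v) :
    ∃ δ > 0, ∀ᶠ x in 𝓝 x₀, ∀ y, ‖y‖ ≤ δ → P (x, y) := by
  rw [nhds_prod_eq] at h
  obtain ⟨Q, hQ, R, hR, hP⟩ := Filter.eventually_prod_iff.mp h
  obtain ⟨δ, hδ, hball⟩ := Metric.nhds_basis_closedBall.eventually_iff.mp hR
  refine ⟨δ, hδ, hQ.mono fun x hx y hy => hP hx (hball ?_)⟩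
  rwa [mem_closedBall_zero_iff]

theorem IsBreatherBranch.exists_norm_sub_le {E : Type*} [NormedAddCommGroup E] [NormedSpace ℂ E]
    (hε₁ : 0 < ε₁) (h : IsBreatherBranch p Ω A₀ ε₁ C₁ ω A) {ψ : Params d → E} {y₀ : E}
    (hψ : AnalyticAt ℂ ψ (solitonParams p Ω A₀)) (hψ₀ : ψ (solitonParams p Ω A₀) = y₀) :
    ∃ C > 0, ∀ᶠ ε in 𝓝[>] (0 : ℝ), ‖ψ (branchParams p Ω ω A ε) - y₀‖ ≤ C * ε := by
  have hθ := h.isBigO_branchParams hε₁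
  obtain ⟨C, hC, hO⟩ := ((hψ.differentiableAt.isBigO_sub.comp_tendsto
    (tendsto_of_isBigO_sub hθ)).trans hθ).exists_pos
  refine ⟨C, hC, ?_⟩
  filter_upwards [hO.bound, self_mem_nhdsWithin] with ε hε hpos
  rw [Function.comp_apply, hψ₀, Real.norm_of_nonneg (le_of_lt hpos)] at hε
  exact hε

theorem floquet_unique {ε δ : ℝ} {Lam ν₀ : ℂ} {v₀ : Harm d} (hε : 0 < ε)
    (h : ∀ μ : ℂ, ‖μ‖ ≤ δ → ∀ D ≠ 0, floqAt (branchParams p Ω ω A ε) (Lam + μ) D = 0 →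
      μ = ν₀ ∧ ∃ c : ℂ, D = c • v₀)
    {mu : ℂ} {D : X2 d} (hD : IsFloquetEigenpair p ε (ω ε) (A ε) mu D)
    (hmu : ‖mu - ε * Lam‖ ≤ δ * ε) :
    mu = ε * (Lam + ν₀) ∧ ∃ c : ℂ, D = c • (weightEquiv d).symm v₀ := by
  have hεC : (ε : ℂ) ≠ 0 := by exact_mod_cast hε.ne'
  obtain ⟨μ, rfl⟩ : ∃ μ : ℂ, mu = ε * (Lam + μ) := ⟨mu / ε - Lam, by field_simp; ring⟩
  have hμ : ‖μ‖ ≤ δ := by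
    rw [mul_add, add_sub_cancel_left, norm_mul, Complex.norm_real, Real.norm_of_nonneg hε.le,
      mul_comm] at hmu
    exact le_of_mul_le_mul_right hmu hε
  obtain ⟨hD₀, hsol⟩ := (isFloquetEigenpair_iff_floqAt (Ω := Ω) hε.ne' _ D).mp hD
  obtain ⟨rfl, c, hc⟩ := h μ hμ _ hD₀ hsol
  exact ⟨rfl, c, by rw [← map_smul, ← hc, LinearIsometryEquiv.symm_apply_apply]⟩

theorem analyticAt_floquet_branch {ε : ℝ} {ν : Params d → ℂ} {v : Params d → Harm d}
    (hν : AnalyticAt ℂ ν (branchParams p Ω ω A ε)) (hv : AnalyticAt ℂ v (branchParams p Ω ω A ε))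
    (hθ : AnalyticAt ℝ (branchParams p Ω ω A) ε) (Lam : ℂ) :
    AnalyticAt ℝ (fun x : ℝ => (x : ℂ) * (Lam + ν (branchParams p Ω ω A x))) ε ∧
      AnalyticAt ℝ (fun x => (weightEquiv d).symm (v (branchParams p Ω ω A x))) ε :=
  ⟨(Complex.ofRealCLM.analyticAt ε).mul (analyticAt_const.add (hν.restrictScalars.comp hθ)),
    ((((weightEquiv d).symm : Harm d →L[ℂ] X2 d).analyticAt _).comp hv).restrictScalars.comp hθ⟩

theorem floquet_error_bounds {ε C : ℝ} {Lam ν₀ : ℂ} {v₀ : Harm d} {b : L2Z d × L2Z d}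
    (hε : 0 < ε) (hν : ‖ν₀‖ ≤ C * ε) (hv : ‖v₀ - resEmb d b‖ ≤ C * ε) :
    ‖ε * (Lam + ν₀) - ε * Lam‖ ≤ (∑' k, invWeight k + 1) * C * ε ^ 2 ∧
      ‖((weightEquiv d).symm v₀).harm 1 - b.1 - Complex.I • b.2‖
          + ‖((weightEquiv d).symm v₀).harm (-1) - b.1 + Complex.I • b.2‖
        ≤ (∑' k, invWeight k + 1) * C * ε ∧
      ∑' m : {m : ℤ // m ≠ 1 ∧ m ≠ -1}, ‖((weightEquiv d).symm v₀).harm m‖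
        ≤ (∑' k, invWeight k + 1) * C * ε := by
  set S := ∑' k, invWeight k
  have hS : 0 ≤ S := tsum_nonneg fun k => (invWeight_pos k).le
  have hC : 0 ≤ C * ε := (norm_nonneg _).trans hν
  have hSC : 0 ≤ S * (C * ε) := mul_nonneg hS hC
  refine ⟨?_, ?_, ?_⟩
  · rw [mul_add, add_sub_cancel_left, norm_mul, Complex.norm_real, Real.norm_of_nonneg hε.le]
    calc ε * ‖ν₀‖ ≤ ε * ((S + 1) * C * ε) := by gcongr; linarith
      _ = (S + 1) * C * ε ^ 2 := by ring
  · linarith [norm_harm_sub_resEmb_add_le v₀ b]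
  · have hfar : ∀ m : {m : ℤ // m ≠ 1 ∧ m ≠ -1}, resEmb d b m = 0 := fun m =>
      pairEmb_of_not _ (not_or.mpr m.2)
    have hle := tsum_norm_harm_weightEquiv_symm_le Subtype.val_injective v₀ hfar
    have hSv := mul_le_mul_of_nonneg_left hv hS
    linarith

theorem exists_floquet_branch (hp : 1 ≤ p) (hreal : ∀ n, (A₀ n).im = 0) {Lam : ℂ}
    {bp bm : L2Z d} (heig : IsSimpleIsolatedEigenpair p Ω A₀ Lam (bp, bm))
    (hcont : 2 * Lam ∉ contSpectrum d Ω) (hε₁ : 0 < ε₁)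
    (hbr : IsBreatherBranch p Ω A₀ ε₁ C₁ ω A) :
    ∃ (ε₀ C₀ δ : ℝ) (lam : ℝ → ℂ) (B : ℝ → X2 d),
      0 < ε₀ ∧ ε₀ ≤ ε₁ ∧ 0 < C₀ ∧ C₀ * ε₀ ≤ δ ∧
      AnalyticOnNhd ℝ lam (Set.Ioo 0 ε₀) ∧ AnalyticOnNhd ℝ B (Set.Ioo 0 ε₀) ∧
      (AnalyticAt ℝ ω 0 → AnalyticAt ℝ A 0 → AnalyticAt ℝ lam 0 ∧ AnalyticAt ℝ B 0) ∧
      ∀ ε ∈ Set.Ioo 0 ε₀,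
        IsFloquetEigenpair p ε (ω ε) (A ε) (lam ε) (B ε) ∧
        ‖lam ε - ε * Lam‖ ≤ C₀ * ε ^ 2 ∧
        ‖(B ε).harm 1 - bp - Complex.I • bm‖ + ‖(B ε).harm (-1) - bp + Complex.I • bm‖
          ≤ C₀ * ε ∧
        ∑' m : {m : ℤ // m ≠ 1 ∧ m ≠ -1}, ‖(B ε).harm m‖ ≤ C₀ * ε ∧
        ∀ (mu : ℂ) (D : X2 d), IsFloquetEigenpair p ε (ω ε) (A ε) mu D →
          ‖mu - ε * Lam‖ ≤ δ * ε → mu = lam ε ∧ ∃ c : ℂ, D = c • B ε := by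
  obtain ⟨ν, v, hν, hv, hν₀, hv₀, hsol, hlocal⟩ := exists_floquet_solution hp hreal heig hcont
  obtain ⟨δ, hδ, huniq⟩ := exists_forall_norm_le_of_eventually_nhds hlocal
  obtain ⟨C, hC, herr⟩ :=
    hbr.exists_norm_sub_le hε₁ (y₀ := (0, resEmb d (bp, bm))) (hν.prod hv) (Prod.ext hν₀ hv₀)
  set θ := branchParams p Ω ω A
  have hθ : Filter.Tendsto θ (𝓝[>] 0) (𝓝 (solitonParams p Ω A₀)) :=
    tendsto_of_isBigO_sub (hbr.isBigO_branchParams hε₁)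
  have hS : 0 ≤ ∑' k, invWeight k := tsum_nonneg fun k => (invWeight_pos k).le
  have hC₀ : 0 < (∑' k, invWeight k + 1) * C := by positivity
  have hnear := herr.and
    ((hθ.eventually (hν.eventually_analyticAt.and hv.eventually_analyticAt)).and
      (hθ.eventually (hsol.and huniq)))
  obtain ⟨ε₀, ⟨hε₀, hε₀le⟩, hnear⟩ :=
    (mem_nhdsGT_iff_exists_mem_Ioc_Ioo_subset (lt_min hε₁ (div_pos hδ hC₀))).mp hnear
  have hε₀₁ : ε₀ ≤ ε₁ := hε₀le.trans (min_le_left _ _)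
  have analytic : ∀ ε ∈ Set.Ioo 0 ε₀, AnalyticAt ℝ (fun x : ℝ => (x : ℂ) * (Lam + ν (θ x))) ε ∧
      AnalyticAt ℝ (fun x => (weightEquiv d).symm (v (θ x))) ε := fun ε hε => by
    have hε' : ε ∈ Set.Ioo 0 ε₁ := ⟨hε.1, hε.2.trans_le hε₀₁⟩
    have hω := hbr.analytic_freq ε hε'
    exact analyticAt_floquet_branch (hnear hε).2.1.1 (hnear hε).2.1.2
      (analyticAt_branchParams hω (analyticAt_freqRatio hε.1.ne' hω) (hbr.analytic_harm ε hε')) Lam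
  refine ⟨ε₀, (∑' k, invWeight k + 1) * C, δ, fun x : ℝ => (x : ℂ) * (Lam + ν (θ x)),
    fun x => (weightEquiv d).symm (v (θ x)), hε₀, hε₀₁, hC₀,
    (le_div_iff₀' hC₀).mp (hε₀le.trans (min_le_right _ _)), fun ε hε => (analytic ε hε).1,
    fun ε hε => (analytic ε hε).2, fun hω hA => ?_, fun ε hε => ?_⟩
  · obtain ⟨hθa, hθ₀⟩ := hbr.analyticAt_branchParams_zero hε₁ hω hA
    exact analyticAt_floquet_branch (by rwa [hθ₀]) (by rwa [hθ₀]) hθa Lam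
  · obtain ⟨hbound, -, ⟨hne, hzero⟩, huniq⟩ := hnear hε
    obtain ⟨hlam, hres, hrest⟩ := floquet_error_bounds (Lam := Lam) (b := (bp, bm)) hε.1
      (by simpa using (norm_fst_le _).trans hbound) ((norm_snd_le _).trans hbound)
    refine ⟨?_, hlam, hres, hrest, fun mu D hD hmu => floquet_unique hε.1 huniq hD hmu⟩
    rw [isFloquetEigenpair_iff_floqAt (Ω := Ω) hε.1.ne', LinearIsometryEquiv.apply_symm_apply]
    exact ⟨hne, hzero⟩

end FloquetBranch

section Symmetry

variable {d : ℕ} {T : Harm d → Harm d} {χ : ℂ →ₐ[ℝ] ℂ} {e : ℤ ≃+ ℤ}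

theorem addEquiv_int_sq (e : ℤ ≃+ ℤ) (m : ℤ) : e m ^ 2 = m ^ 2 := by
  rcases Int.addEquiv_eq_refl_or_neg e with rfl | rfl
  · rfl
  · exact neg_sq m

theorem addEquiv_int_resonant_iff (e : ℤ ≃+ ℤ) (m : ℤ) :
    e m = 1 ∨ e m = -1 ↔ m = 1 ∨ m = -1 := by
  rw [← sq_eq_one_iff, ← sq_eq_one_iff, addEquiv_int_sq]

theorem map_invWeight (χ : ℂ →ₐ[ℝ] ℂ) (e : ℤ ≃+ ℤ) (m : ℤ) :
    χ (invWeight (e m)) = invWeight m := by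
  have h : ((e m : ℤ) : ℝ) ^ 2 = (m : ℝ) ^ 2 := by exact_mod_cast addEquiv_int_sq e m
  rw [invWeight, h, ← invWeight]
  exact χ.commutes _

theorem map_lap (χ : ℂ →ₐ[ℝ] ℂ) (u : (Fin d → ℤ) → ℂ) (n : Fin d → ℤ) :
    χ (lap u n) = lap (fun k => χ (u k)) n := by
  simp only [lap, map_sum, map_sub, map_add, map_mul, map_ofNat]

theorem symm_invWeightOp (hT : ∀ y m n, T y m n = χ (y (e m) n)) (y : Harm d) :
    T (invWeightOp d y) = invWeightOp d (T y) := by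
  refine harm_ext fun m n => ?_
  simp only [hT, invWeightOp_apply, lp.coeFn_smul, Pi.smul_apply, smul_eq_mul, map_mul,
    map_invWeight]

theorem symm_conv (hT : ∀ y m n, T y m n = χ (y (e m) n)) (y z : Harm d) :
    T (conv d y z) = conv d (T y) (T z) := by
  have hχ : Continuous χ := χ.toLinearMap.continuous_of_finiteDimensional
  refine harm_ext fun m n => ?_
  have hsum := (e.toEquiv.hasSum_iff.mpr (hasSum_conv_apply y z (e m) n)).map χ hχ
  rw [hT]
  refine hsum.unique ?_
  convert hasSum_conv_apply (T y) (T z) m n using 2 with k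
  rw [← symm_invWeightOp hT, hT, hT, map_sub e]
  exact map_mul χ _ _

theorem symm_conv_pow (hT : ∀ y m n, T y m n = χ (y (e m) n)) (y z : Harm d) (k : ℕ) :
    T ((conv d y ^ k) z) = (conv d (T y) ^ k) (T z) := by
  induction k with
  | zero => rfl
  | succ k ih =>
    rw [pow_succ', pow_succ', mul_apply_eq_comp, mul_apply_eq_comp, symm_conv hT, ih]

theorem symm_floq (hT : ∀ y m n, T y m n = χ (y (e m) n)) (ε ω σ : ℂ)
    {W W' : Harm d →L[ℂ] Harm d} (hW : ∀ z, T (W z) = W' (T z)) (y : Harm d) :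
    T (floq d ε ω σ 0 W y) = floq d (χ ε) (χ ω) (χ σ) 0 W' (T y) := by
  have symbol (ε ω : ℂ) (k : ℤ) :
      1 + (ε * 0 + Complex.I * k * ω) ^ 2 = 1 - ((k ^ 2 : ℤ) : ℂ) * ω ^ 2 := by
    push_cast
    linear_combination (k * ω) ^ 2 * Complex.I_mul_I
  have hlap (z : Harm d) (m : ℤ) (n : Fin d → ℤ) :
      χ (lapOp d (z (e m)) n) = lapOp d (T z m) n := by
    rw [lapOp_apply, lapOp_apply, map_lap, funext fun k => hT z m k]
  refine harm_ext fun m n => ?_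
  rw [hT, floq_apply, floq_apply, ← symm_invWeightOp hT, ← hW]
  simp only [addEquiv_int_resonant_iff]
  split_ifs with hm
  · simp only [lp.coeFn_sub, lp.coeFn_add, lp.coeFn_smul, Pi.sub_apply, Pi.add_apply,
      Pi.smul_apply, smul_eq_mul, map_sub, map_add, map_mul, hlap, hT, mul_zero, zero_mul,
      add_zero, zero_pow two_ne_zero]
  · simp only [symbol, addEquiv_int_sq, lp.coeFn_sub, lp.coeFn_add, lp.coeFn_smul, Pi.sub_apply,
      Pi.add_apply, Pi.smul_apply, smul_eq_mul, map_sub, map_add, map_mul, map_pow, map_one,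
      map_intCast, hlap, hT]

/-- The rescaled breather equation, with frequency `1 - ε Ω / 2`; accordingly
`σ = (1 - ω²) / ε = Ω - ε Ω² / 4`. -/
def breatherEq (d p : ℕ) (Ω : ℝ) (v : ℂ × Harm d) : Harm d :=
  floq d v.1 (1 - v.1 * Ω / 2) (Ω - v.1 * Ω ^ 2 / 4) 0 (conv d v.2 ^ (2 * p)) v.2

theorem contDiff_breatherEq (p : ℕ) (Ω : ℝ) : ContDiff ℂ ⊤ (breatherEq d p Ω) := by
  unfold breatherEq floq
  fun_prop

theorem symm_breatherEq (hT : ∀ y m n, T y m n = χ (y (e m) n)) (p : ℕ) (Ω : ℝ)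
    (v : ℂ × Harm d) : T (breatherEq d p Ω v) = breatherEq d p Ω (χ v.1, T v.2) := by
  have hΩ : χ Ω = Ω := χ.commutes Ω
  rw [breatherEq, symm_floq hT _ _ _ (fun z => symm_conv_pow hT v.2 z (2 * p)), breatherEq]
  simp only [map_sub, map_div₀, map_mul, map_pow, map_one, map_ofNat, hΩ]

end Symmetry

section Reflection

variable {d : ℕ}

/-- The reflection `(y_m) ↦ (y_{-m})`. -/
def reflOp (d : ℕ) : Harm d →L[ℂ] Harm d := reindexOp (Equiv.neg ℤ)

theorem reflOp_apply (y : Harm d) (m : ℤ) : reflOp d y m = y (-m) := rfl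

theorem reflOp_apply_apply (y : Harm d) (m : ℤ) (n : Fin d → ℤ) :
    reflOp d y m n = AlgHom.id ℝ ℂ (y (AddEquiv.neg ℤ m) n) := rfl

theorem star_harm_apply_apply (y : Harm d) (m : ℤ) (n : Fin d → ℤ) :
    (star y) m n = Complex.conjAe.toAlgHom (y (AddEquiv.refl ℤ m) n) := rfl

/-- The projection to the sequences of harmonics that are even in `m`. -/
def evenProj (d : ℕ) : Harm d →L[ℂ] Harm d := (2⁻¹ : ℂ) • (1 + reflOp d)

theorem evenProj_apply (y : Harm d) : evenProj d y = (2⁻¹ : ℂ) • (y + reflOp d y) := rfl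

theorem reflOp_evenProj (y : Harm d) : reflOp d (evenProj d y) = evenProj d y := by
  refine lp.ext (funext fun m => ?_)
  simp only [evenProj_apply, reflOp_apply, lp.coeFn_smul, lp.coeFn_add, Pi.smul_apply,
    Pi.add_apply, neg_neg, add_comm]

theorem evenProj_eq_self_iff {y : Harm d} : evenProj d y = y ↔ reflOp d y = y := by
  refine ⟨fun h => by rw [← h, reflOp_evenProj], fun h => ?_⟩
  rw [evenProj_apply, h]
  module

theorem reflOp_solitonHarm (A : L2Z d) : reflOp d (solitonHarm A) = solitonHarm A :=
  lp.ext (funext fun m => pairEmb_neg _ m)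

theorem star_solitonHarm {A : L2Z d} (hA : ∀ n, (A n).im = 0) :
    star (solitonHarm A) = solitonHarm A := by
  have hs : star ((2 : ℂ) • A) = (2 : ℂ) • A := lp.ext <| funext fun n =>
    Complex.conj_eq_iff_im.mpr (by
      rw [lp.coeFn_smul, Pi.smul_apply, smul_eq_mul, Complex.mul_im, hA n]; simp)
  refine lp.ext (funext fun m => ?_)
  rw [lp.star_apply, solitonHarm, pairEmb_apply, Prod.smul_mk]
  split_ifs
  exacts [hs, hs, star_zero _]

theorem reflOp_nonresInv (z : Harm d) : reflOp d (nonresInv d z) = nonresInv d (reflOp d z) := by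
  refine lp.ext (funext fun m => ?_)
  have hm : -m = 1 ∨ -m = -1 ↔ m = 1 ∨ m = -1 := by omega
  simp only [reflOp_apply, nonresInv_apply, hm, invWeight_neg, Int.cast_neg, neg_sq]

end Reflection

section Nonlinearity

variable {d : ℕ}

theorem commute_convTerm (y z : Harm d) (k l : ℤ) : Commute (convTerm y k) (convTerm z l) := by
  refine ContinuousLinearMap.ext fun x => harm_ext fun m n => ?_
  simp only [mul_apply_eq_comp, convTerm_apply]
  rw [sub_right_comm, mul_left_comm]

theorem commute_conv (y z : Harm d) : Commute (conv d y) (conv d z) :=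
  Commute.tsum_right _ fun l => Commute.tsum_left _ fun k => commute_convTerm y z k l

theorem conv_invWeightOp_comm (y z : Harm d) :
    conv d y (invWeightOp d z) = conv d z (invWeightOp d y) := by
  refine harm_ext fun m n => ?_
  rw [conv_apply, conv_apply, ← (Equiv.subLeft m).tsum_eq]
  refine tsum_congr fun k => ?_
  rw [Equiv.subLeft_apply, sub_sub_cancel, mul_comm]

theorem hasFDerivAt_conv_pow (k : ℕ) (y : Harm d) :
    HasFDerivAt (fun y : Harm d => (conv d y ^ k) (invWeightOp d y))
      ((k + 1 : ℂ) • (conv d y ^ k * invWeightOp d)) y := by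
  induction k with
  | zero =>
    rw [Nat.cast_zero, zero_add, one_smul, pow_zero, one_mul]
    exact (invWeightOp d).hasFDerivAt
  | succ k ih =>
    simp only [pow_succ', mul_apply_eq_comp]
    refine ((conv d).hasFDerivAt.clm_apply ih).congr_fderiv (ContinuousLinearMap.ext fun h => ?_)
    have hswap : conv d h ((conv d y ^ k) (invWeightOp d y))
        = conv d y ((conv d y ^ k) (invWeightOp d h)) :=
      calc conv d h ((conv d y ^ k) (invWeightOp d y))
        _ = (conv d y ^ k) (conv d h (invWeightOp d y)) :=
          congrArg (· (invWeightOp d y)) ((commute_conv h y).pow_right k)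
        _ = (conv d y ^ k) (conv d y (invWeightOp d h)) := by rw [conv_invWeightOp_comm]
        _ = conv d y ((conv d y ^ k) (invWeightOp d h)) :=
          congrArg (· (invWeightOp d h)) ((Commute.refl (conv d y)).pow_left k)
    calc conv d y ((k + 1 : ℂ) • (conv d y ^ k) (invWeightOp d h))
          + conv d h ((conv d y ^ k) (invWeightOp d y))
      _ = ((k + 1 : ℂ) + 1) • conv d y ((conv d y ^ k) (invWeightOp d h)) := by
        rw [hswap, map_smul, add_smul (k + 1 : ℂ) 1, one_smul]
      _ = (((k + 1 : ℕ) : ℂ) + 1) • conv d y ((conv d y ^ k) (invWeightOp d h)) := by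
        rw [Nat.cast_succ]

theorem floq_eq_add (ε ω σ η : ℂ) (W : Harm d →L[ℂ] Harm d) :
    floq d ε ω σ η W = floq d ε ω σ η 0
      + (resonantProj d + ε • (1 - resonantProj d)) * (W * invWeightOp d) := by
  simp only [floq, sub_mul, mul_sub, zero_mul, mul_zero]
  abel

theorem breatherEq_zero (p : ℕ) (Ω : ℝ) (y : Harm d) :
    breatherEq d p Ω (0, y) = floq d 0 1 Ω 0 (conv d y ^ (2 * p)) y := by
  simp only [breatherEq, zero_mul, zero_div, sub_zero]

theorem hasFDerivAt_breatherEq (p : ℕ) (Ω : ℝ) (A : L2Z d) :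
    HasFDerivAt (fun y => breatherEq d p Ω (0, y)) (floq d 0 1 Ω 0 (solitonPot p A))
      (solitonHarm A) := by
  set Q := resonantProj d + (0 : ℂ) • (1 - resonantProj d)
  have split : (fun y => breatherEq d p Ω (0, y))
      = fun y => floq d 0 1 Ω 0 0 y + Q ((conv d y ^ (2 * p)) (invWeightOp d y)) := by
    funext y
    rw [breatherEq_zero, floq_eq_add]
    rfl
  rw [split]
  refine ((floq d 0 1 Ω 0 0).hasFDerivAt.add
    (Q.hasFDerivAt.comp (solitonHarm A) (hasFDerivAt_conv_pow (2 * p) _))).congr_fderiv ?_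
  rw [floq_eq_add (W := solitonPot p A), solitonPot, smul_mul_assoc, Nat.cast_mul, Nat.cast_ofNat,
    add_comm (2 * p : ℂ)]
  rfl

end Nonlinearity

section BreatherSolution

variable {d p : ℕ} {Ω : ℝ} {A : L2Z d}

theorem reflOp_solitonPot (z : Harm d) :
    reflOp d (solitonPot p A z) = solitonPot p A (reflOp d z) := by
  rw [solitonPot, smul_apply, smul_apply, map_smul, symm_conv_pow reflOp_apply_apply,
    reflOp_solitonHarm]

theorem evenProj_breatherEq (ε : ℂ) {y : Harm d} (hy : reflOp d y = y) :
    evenProj d (breatherEq d p Ω (ε, y)) = breatherEq d p Ω (ε, y) := by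
  rw [evenProj_eq_self_iff, symm_breatherEq reflOp_apply_apply, hy]
  rfl

theorem breatherEq_solitonHarm (hp : 1 ≤ p) (hA : ∀ n, (A n).im = 0) (hsol : IsSoliton p Ω A) :
    breatherEq d p Ω (0, solitonHarm A) = 0 := by
  have soliton_eq : (Ω : ℂ) • A + (gam p : ℂ) • potOp p A A - lapOp d A = 0 := by
    refine lp.ext (funext fun n => ?_)
    simp only [lp.coeFn_sub, lp.coeFn_add, lp.coeFn_smul, Pi.sub_apply, Pi.add_apply,
      Pi.smul_apply, smul_eq_mul, potOp_apply, lapOp_apply, ← hsol n, lp.coeFn_zero, Pi.zero_apply]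
    ring
  have row_one : breatherEq d p Ω (0, solitonHarm A) 1 = 0 := by
    rw [breatherEq_zero, floq_apply, if_pos (Or.inl rfl), conv_solitonHarm_pow_apply hA,
      solitonHarm, invWeightOp_pairEmb, sum_choose_smul_pairEmb_one hp, pairEmb_one, ← add_smul,
      ← gam_eq_choose_add, map_smul, ← soliton_eq]
    module
  refine lp.ext (funext fun m => ?_)
  by_cases hm : m = 1 ∨ m = -1
  · rcases hm with rfl | rfl
    · exact row_one
    · rw [← reflOp_apply, evenProj_eq_self_iff.mp (evenProj_breatherEq 0 (reflOp_solitonHarm A))]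
      exact row_one
  · rw [breatherEq_zero, floq_zero_apply_of_not _ _ _ _ hm, solitonHarm, pairEmb_of_not _ hm,
      smul_zero]
    rfl

theorem resEmb_fst_resProj {y : Harm d} (hy : reflOp d y = y)
    (hsupp : ∀ m, ¬(m = 1 ∨ m = -1) → y m = 0) : resEmb d ((resProj d y).1, 0) = y := by
  have hsnd : (resProj d y).2 = 0 := by
    rw [resProj_apply, ← reflOp_apply, hy, sub_self, smul_zero]
  rw [← hsnd, resEmb_resProj hsupp]

theorem rowEmb_snd_rowProj {y : Harm d} (hy : reflOp d y = y)
    (hsupp : ∀ m, ¬(m = 1 ∨ m = -1) → y m = 0) : rowEmb d (0, (rowProj y).2) = y := by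
  have hfst : (rowProj y).1 = 0 := by
    rw [rowProj, ← reflOp_apply, hy, sub_self, smul_zero]
  rw [← hfst, rowEmb_rowProj hsupp]

theorem bijOn_floq_zero_even (hp : 1 ≤ p) (hA : ∀ n, (A n).im = 0)
    (hL : Function.Bijective (Lplus p Ω A)) :
    Set.BijOn (floq d 0 1 Ω 0 (solitonPot p A)) {y | evenProj d y = y} {y | evenProj d y = y} := by
  set L := floq d 0 1 Ω 0 (solitonPot p A)
  simp only [evenProj_eq_self_iff]
  have reflOp_L (y : Harm d) : reflOp d (L y) = L (reflOp d y) :=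
    symm_floq reflOp_apply_apply _ _ _ reflOp_solitonPot y
  refine bijOn_of_comm_square (T := (L : Harm d →ₗ[ℂ] Harm d))
    (M := (Lplus p Ω A : L2Z d →ₗ[ℂ] L2Z d))
    (r := ((resEmb d).comp (.inl ℂ _ _) : L2Z d →ₗ[ℂ] Harm d))
    (s := ((rowEmb d).comp (.inr ℂ _ _) : L2Z d →ₗ[ℂ] Harm d))
    (X' := LinearMap.eqLocus (reflOp d : Harm d →ₗ[ℂ] Harm d) .id)
    (Z' := LinearMap.eqLocus (reflOp d : Harm d →ₗ[ℂ] Harm d) .id)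
    (fun y hy => (reflOp_L y).trans (congrArg L hy))
    (fun x => ?_) (rowEmb_injective.comp (Prod.mk_right_injective 0)) (fun x => ?_) hL ?_ ?_
  · change reflOp d (resEmb d (x, 0)) = resEmb d (x, 0)
    rw [resEmb_soliton, reflOp_solitonHarm]
  · change L (resEmb d (x, 0)) = rowEmb d (0, Lplus p Ω A x)
    rw [floq_zero_resEmb hp Ω hA, mul_zero, zero_smul, sub_zero]
    refine congrArg (rowEmb d) (Prod.ext ?_ rfl)
    change -Lminus p Ω A 0 = 0
    rw [map_zero, neg_zero]
  · rintro y hy ⟨w, hw⟩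
    exact ⟨(resProj d y).1,
      resEmb_fst_resProj hy fun m hm => apply_eq_zero_of_floq_zero_eq_rowEmb hw.symm hm⟩
  · rintro z (hz : reflOp d z = z)
    have heven : reflOp d (nonresInv d z) = nonresInv d z := by rw [reflOp_nonresInv, hz]
    have hresidual : reflOp d (z - L (nonresInv d z)) = z - L (nonresInv d z) := by
      rw [map_sub, reflOp_L, heven, hz]
    exact ⟨nonresInv d z, heven, (rowProj (z - L (nonresInv d z))).2,
      rowEmb_snd_rowProj hresidual fun m hm =>
        sub_floq_zero_nonresInv_apply_of_not _ _ _ _ hm⟩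

theorem exists_breather_solution (hp : 1 ≤ p) (hΩ : Ω ∉ Set.Icc (-(4 * (d : ℝ))) 0)
    (hA : ∀ n, (A n).im = 0) (hsol : IsSoliton p Ω A)
    (hker : ∀ f : L2Z d, Lplus p Ω A f = 0 → f = 0) :
    ∃ ψ : ℂ → Harm d, AnalyticAt ℂ ψ 0 ∧ ψ 0 = solitonHarm A ∧
      ∀ᶠ ε : ℝ in 𝓝 0, breatherEq d p Ω (ε, ψ ε) = 0 ∧ reflOp d (ψ ε) = ψ ε ∧
        star (ψ ε) = ψ ε := by
  obtain ⟨ψ, hψ, hψ₀, hiff⟩ := exists_implicitFunction_on_range (G := breatherEq d p Ω)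
    (P := evenProj d) (fun y => evenProj_eq_self_iff.mpr (reflOp_evenProj y))
    (fun ε y => evenProj_breatherEq ε (reflOp_evenProj y))
    (contDiff_breatherEq p Ω).contDiffAt.analyticAt (breatherEq_solitonHarm hp hA hsol)
    (evenProj_eq_self_iff.mpr (reflOp_solitonHarm A)) (hasFDerivAt_breatherEq p Ω A)
    (bijOn_floq_zero_even hp hA
      (ContinuousLinearMap.isUnit_iff_bijective.mp (isUnit_Lplus hp hΩ hA hker)))
  refine ⟨ψ, hψ, hψ₀, ?_⟩
  have hofReal : Filter.Tendsto (fun ε : ℝ => (ε : ℂ)) (𝓝 0) (𝓝 0) :=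
    Complex.continuous_ofReal.tendsto' 0 0 Complex.ofReal_zero
  have hψ_lim : Filter.Tendsto (fun ε : ℝ => ψ ε) (𝓝 0) (𝓝 (solitonHarm A)) :=
    hψ₀ ▸ hψ.continuousAt.tendsto.comp hofReal
  have hstar_lim : Filter.Tendsto (fun ε : ℝ => star (ψ ε)) (𝓝 0) (𝓝 (solitonHarm A)) :=
    star_solitonHarm hA ▸ hψ_lim.star
  filter_upwards [(hofReal.prodMk_nhds hψ_lim).eventually hiff,
    (hofReal.prodMk_nhds hstar_lim).eventually hiff] with ε hiffψ hiffstar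
  obtain ⟨heven, hzero⟩ := hiffψ.mpr rfl
  rw [evenProj_eq_self_iff] at heven hiffstar
  refine ⟨hzero, heven, (hiffstar.mp ⟨?_, ?_⟩).symm⟩
  · exact congrArg star heven
  · have h := symm_breatherEq star_harm_apply_apply p Ω ((ε : ℂ), ψ ε)
    rw [hzero, star_zero] at h
    exact (h.trans (congrArg (fun z => breatherEq d p Ω (z, star (ψ ε)))
      (Complex.conj_ofReal ε))).symm

end BreatherSolution

section BreatherBranch

variable {d p : ℕ} {Ω : ℝ}

theorem isBreather_weightEquiv_symm {ε : ℝ} (hε : ε ≠ 0) {y : Harm d}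
    (hzero : breatherEq d p Ω (ε, y) = 0) (heven : reflOp d y = y) (hstar : star y = y) :
    IsBreather p ε (1 - ε * Ω / 2) ((weightEquiv d).symm y) where
  real m n := by
    have hreal : starRingEnd ℂ (y m n) = y m n := congrArg (fun y : Harm d => y m n) hstar
    rw [harm_weightEquiv_symm, lp.coeFn_smul, Pi.smul_apply, smul_eq_mul, Complex.im_ofReal_mul,
      Complex.conj_eq_iff_im.mp hreal, mul_zero]
  even m := by
    rw [harm_weightEquiv_symm, harm_weightEquiv_symm, invWeight_neg, ← reflOp_apply, heven]
  eq := by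
    rw [breather_eq_iff (σ := Ω - ε * Ω ^ 2 / 4) hε (by push_cast; ring),
      LinearIsometryEquiv.apply_symm_apply]
    push_cast
    exact hzero

theorem norm_harm_sub_soliton_le (A : L2Z d) (y : Harm d) :
    ‖((weightEquiv d).symm y).harm 0‖ + ‖((weightEquiv d).symm y).harm 1 - A‖
        + ∑' m : ℕ, ‖((weightEquiv d).symm y).harm (m + 2)‖
      ≤ (∑' k, invWeight k + 2) * ‖y - solitonHarm A‖ := by
  have h₀ := norm_harm_weightEquiv_symm_sub_le y (solitonHarm A) 0
  have h₁ := norm_harm_weightEquiv_symm_sub_le y (solitonHarm A) 1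
  have h₂ := tsum_norm_harm_weightEquiv_symm_le (i := fun m : ℕ => (m : ℤ) + 2)
    (fun a b h => by simpa using h) y (y₀ := solitonHarm A) fun m => pairEmb_of_not _ (by omega)
  rw [solitonHarm, invWeightOp_pairEmb, ← solitonHarm, pairEmb_of_not _ (by norm_num), sub_zero]
    at h₀
  rw [solitonHarm, invWeightOp_pairEmb, ← solitonHarm, pairEmb_one, invWeight_one] at h₁
  have hw : invWeight 0 = 1 := by norm_num [invWeight]
  rw [hw] at h₀
  linarith [norm_nonneg (y - solitonHarm A)]

theorem analyticAt_weightEquiv_symm_comp_ofReal {ψ : ℂ → Harm d} {ε : ℝ}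
    (hψ : AnalyticAt ℂ ψ ε) : AnalyticAt ℝ (fun x : ℝ => (weightEquiv d).symm (ψ x)) ε :=
  ((((weightEquiv d).symm : Harm d →L[ℂ] X2 d).analyticAt _).comp hψ).restrictScalars.comp
    (Complex.ofRealCLM.analyticAt ε)

theorem exists_breather_branch (hp : 1 ≤ p) (hΩ : Ω ∉ Set.Icc (-(4 * (d : ℝ))) 0) {A₀ : L2Z d}
    (hreal : ∀ n, (A₀ n).im = 0) (hsol : IsSoliton p Ω A₀)
    (hker : ∀ f : L2Z d, Lplus p Ω A₀ f = 0 → f = 0) :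
    ∃ (ε₁ C₁ : ℝ) (ω : ℝ → ℝ) (A : ℝ → X2 d), 0 < ε₁ ∧ IsBreatherBranch p Ω A₀ ε₁ C₁ ω A ∧
      AnalyticAt ℝ ω 0 ∧ AnalyticAt ℝ A 0 := by
  obtain ⟨ψ, hψ, hψ₀, hsolution⟩ := exists_breather_solution hp hΩ hreal hsol hker
  have hofReal : Filter.Tendsto (fun ε : ℝ => (ε : ℂ)) (𝓝 0) (𝓝 0) :=
    Complex.continuous_ofReal.tendsto' 0 0 Complex.ofReal_zero
  obtain ⟨C, hC, hbound⟩ := hψ.differentiableAt.isBigO_sub.exists_pos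
  obtain ⟨ε₁, hε₁, hnear⟩ := Metric.eventually_nhds_iff.mp (hsolution.and
    ((hofReal.eventually hbound.bound).and (hofReal.eventually hψ.eventually_analyticAt)))
  replace hnear (ε : ℝ) (hε : ε ∈ Set.Ioo 0 ε₁) :=
    hnear (y := ε) (by rw [Real.dist_0_eq_abs, abs_of_pos hε.1]; exact hε.2)
  have hfreq (ε : ℝ) : AnalyticAt ℝ (fun x => 1 - x * Ω / 2) ε := by fun_prop
  have hS : 0 ≤ ∑' k, invWeight k + 2 :=
    add_nonneg (tsum_nonneg fun k => (invWeight_pos k).le) zero_le_two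
  refine ⟨ε₁, (∑' k, invWeight k + 2) * C, fun ε => 1 - ε * Ω / 2,
    fun ε => (weightEquiv d).symm (ψ ε), hε₁, ⟨fun ε _ => hfreq ε, fun ε hε => ?_,
      fun ε hε => ?_, fun ε _ => ?_, fun ε hε => ?_⟩, hfreq 0, ?_⟩
  · exact analyticAt_weightEquiv_symm_comp_ofReal (hnear ε hε).2.2
  · obtain ⟨hzero, heven, hstar⟩ := (hnear ε hε).1
    exact isBreather_weightEquiv_symm hε.1.ne' hzero heven hstar
  · rw [sub_right_comm, sub_self, zero_sub, neg_add_cancel, abs_zero]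
    positivity
  · refine (norm_harm_sub_soliton_le A₀ (ψ ε)).trans ?_
    rw [mul_assoc]
    refine mul_le_mul_of_nonneg_left ?_ hS
    simpa only [hψ₀, sub_zero, Complex.norm_real, Real.norm_of_nonneg hε.1.le]
      using (hnear ε hε).2.1
  · exact analyticAt_weightEquiv_symm_comp_ofReal (Complex.ofReal_zero.symm ▸ hψ)

end BreatherBranch

end KGBreather

end

theorem theorem2 (d p : ℕ) (hd : 1 ≤ d) (hp : 1 ≤ p)
    (Ω : ℝ) (hΩ : Ω ∉ Set.Icc (-(4 * (d : ℝ))) 0)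
    (A₀ : KGBreather.L2Z d) (hreal : ∀ n, (A₀ n).im = 0)
    (hsol : KGBreather.IsSoliton p Ω A₀)
    (hker : ∀ f : KGBreather.L2Z d, KGBreather.Lplus p Ω A₀ f = 0 → f = 0)
    (Lam : ℂ) (bp bm : KGBreather.L2Z d)
    (heig : KGBreather.IsSimpleIsolatedEigenpair p Ω A₀ Lam (bp, bm))
    (hcont : 2 * Lam ∉ KGBreather.contSpectrum d Ω) :
    (∃ (ε₁ C₁ : ℝ) (ω : ℝ → ℝ) (A : ℝ → KGBreather.X2 d), 0 < ε₁ ∧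
      KGBreather.IsBreatherBranch p Ω A₀ ε₁ C₁ ω A ∧
      AnalyticAt ℝ ω 0 ∧ AnalyticAt ℝ A 0) ∧
    ∀ (ε₁ C₁ : ℝ) (ω : ℝ → ℝ) (A : ℝ → KGBreather.X2 d), 0 < ε₁ →
      KGBreather.IsBreatherBranch p Ω A₀ ε₁ C₁ ω A →
      ∃ (ε₀ C₀ δ : ℝ) (lam : ℝ → ℂ) (B : ℝ → KGBreather.X2 d),
        0 < ε₀ ∧ ε₀ ≤ ε₁ ∧ 0 < C₀ ∧ C₀ * ε₀ ≤ δ ∧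
        AnalyticOnNhd ℝ lam (Set.Ioo 0 ε₀) ∧ AnalyticOnNhd ℝ B (Set.Ioo 0 ε₀) ∧
        (AnalyticAt ℝ ω 0 → AnalyticAt ℝ A 0 → AnalyticAt ℝ lam 0 ∧ AnalyticAt ℝ B 0) ∧
        ∀ ε ∈ Set.Ioo 0 ε₀,
          KGBreather.IsFloquetEigenpair p ε (ω ε) (A ε) (lam ε) (B ε) ∧
          ‖lam ε - ε * Lam‖ ≤ C₀ * ε ^ 2 ∧
          ‖(B ε).harm 1 - bp - Complex.I • bm‖ + ‖(B ε).harm (-1) - bp + Complex.I • bm‖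
            ≤ C₀ * ε ∧
          ∑' m : {m : ℤ // m ≠ 1 ∧ m ≠ -1}, ‖(B ε).harm m‖ ≤ C₀ * ε ∧
          ∀ (mu : ℂ) (D : KGBreather.X2 d),
            KGBreather.IsFloquetEigenpair p ε (ω ε) (A ε) mu D →
            ‖mu - ε * Lam‖ ≤ δ * ε → mu = lam ε ∧ ∃ c : ℂ, D = c • B ε :=
  ⟨KGBreather.exists_breather_branch hp hΩ hreal hsol hker, fun _ _ _ _ hε₁ hbr =>
    KGBreather.exists_floquet_branch hp hreal heig hcont hε₁ hbr⟩
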